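/- **Setting.** Let $f:\{0,1\}^n\to\{\pm1\}$. The total influence of $f$ is $\mathrm{Inf}(f)=\sum_{i=1}^n\Pr_x[f(x)\neq f(x^{\oplus i})]$, with $x$ uniform on $\{0,1\}^n$. The size of a decision tree is its number of leaves. A (randomized) query strategy adaptively reveals coordinates of an unknown input $x$ and then outputs a value; in the unit-cost setting its cost on $x$ is the number of coordinates it reveals. It is an $\varepsilon$-error strategy for $f$ if its output differs from $f(x)$ with probability at most $\varepsilon$ over uniform $x$ and its own coins, and its expected cost is taken over the same randomness. Let $\mathrm{opt}(f,\varepsilon)$ be the least expected cost of an $\varepsilon$-error randomized strategy for $f$, with no computational restriction. Running time is the number of steps of a uniform randomized oracle program (a WHILE program on binary trees, each elementary operation, test, coin toss or oracle call being one step; this is polynomially equivalent to oracle Turing machines). Let $K\subseteq\mathbb N$ (e.g. $K=\mathbb N$, which covers all polynomial size bounds at once, or $K=\{k\}$). **Hypothesis.** There are one program $\mathcal S$ and one constant $C$ such that for every $k\in K$ and every rational $\varepsilon\in(0,\frac12)$ there are a polynomial $p$ and a function $g:\mathbb R\to\mathbb R$, bounded above on every interval $[0,b]$ and with $g(u)=o(u)$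 as $u\to\infty$, for which the following holds for every $n$ and every $f:\{0,1\}^n\to\{\pm1\}$ computable by a decision tree of size at most $n^k+k$. Given $n$ and $\varepsilon$, blackbox query access to $f$, and the ability to reveal coordinates of the unknown input $x$, the program $\mathcal S$ halts within $p(n)$ steps on all $x$ and all coin outcomes, and it is a $C\varepsilon$-error strategy for $f$ of expected cost at most $$\max\{1,\mathrm{opt}(f,\varepsilon)\}\cdot \max\{0,g(\mathrm{Inf}(f))\}.$$ **Conclusion.** There is one program $L$ such that for every $k\in K$ and all rational $\varepsilon,\delta\in(0,1)$ there is $T:\mathbb N\to\mathbb N$ with $T(n)\le n^{o(\log n)}$ as $n\to\infty$ for which the following holds for every $n$ and every $f:\{0,1\}^n\to\{\pm1\}$ computable by a decision tree of size at most $n^k+k$. Given $n,\varepsilon,\delta$ and query access to $f$, with probability at least $1-\delta$ over its coins $L$ halts within $T(n)$ steps and outputs a decision tree $h$, of size at most $T(n)$, with $\Pr_x[h(x)\neq f(x)]\le\varepsilon$ for uniform $x$. That is, polynomial-size decision trees can be properly PAC learned under the uniform distribution with queries in time $n^{o(\log n)}$. -/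

import Mathlib

open scoped ENNReal Topology Asymptotics

noncomputable section

namespace PricedQuery

/-! ### Boolean functions, decision trees, influence -/

/-- Boolean functions on the cube. The two values of `Bool` stand for `±1`. -/
abbrev BoolFn (n : ℕ) : Type := (Fin n → Bool) → Bool

/-- Decision trees over the coordinates `0, …, n - 1`. At a node the left subtree is followed when
the queried bit is `0` and the right subtree when it is `1`. -/
inductive DTree (n : ℕ) : Type
  | leaf (b : Bool) : DTree n
  | node (i : Fin n) (l r : DTree n) : DTree n

namespace DTree

variable {n : ℕ}

def eval : DTree n → (Fin n → Bool) → Bool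
  | leaf b, _ => b
  | node i l r, x => if x i then r.eval x else l.eval x

/-- The size of a decision tree is its number of leaves. -/
def size : DTree n → ℕ
  | leaf _ => 1
  | node _ l r => l.size + r.size

/-- The total price, relative to the cost vector `c`, of the queries made on the input `x`. -/
def cost (c : Fin n → ℕ) : DTree n → (Fin n → Bool) → ℕ
  | leaf _, _ => 0
  | node i l r, x => c i + if x i then r.cost c x else l.cost c x

end DTree

/-- `f` is computable by a decision tree of size at most `s`. -/
def HasTreeOfSize {n : ℕ} (f : BoolFn n) (s : ℕ) : Prop :=
  ∃ t : DTree n, t.size ≤ s ∧ ∀ x, t.eval x = f x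

/-- The probability, over a uniform random `x`, that `g x ≠ f x`. -/
def disagreement {n : ℕ} (g f : BoolFn n) : ℝ :=
  ((Finset.univ.filter fun x : Fin n → Bool => g x ≠ f x).card : ℝ) / 2 ^ n

/-- The influence of the `i`-th variable. -/
def influence {n : ℕ} (f : BoolFn n) (i : Fin n) : ℝ :=
  disagreement (fun x => f (Function.update x i (!x i))) f

def totalInfluence {n : ℕ} (f : BoolFn n) : ℝ := ∑ i, influence f i

/-! ### The optimal strategy

A deterministic query strategy is a decision tree, and a randomized one is a probability
distribution over decision trees. No computability is demanded of them here. -/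

/-- The error of a randomized strategy, over a uniform random input and the strategy's coins. -/
def strategyError {n : ℕ} (f : BoolFn n) (μ : PMF (DTree n)) : ℝ≥0∞ :=
  ∑' t, μ t * ENNReal.ofReal (disagreement t.eval f)

/-- The expected cost of a randomized strategy, over a uniform random input and its coins. -/
def strategyCost {n : ℕ} (c : Fin n → ℕ) (μ : PMF (DTree n)) : ℝ≥0∞ :=
  ∑' t, μ t * ((∑ x : Fin n → Bool, (t.cost c x : ℝ≥0∞)) / 2 ^ n)

/-- The least expected cost of an `ε`-error strategy for `f`. -/
def opt {n : ℕ} (f : BoolFn n) (c : Fin n → ℕ) (ε : ℝ) : ℝ≥0∞ :=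
  ⨅ (μ : PMF (DTree n)) (_ : strategyError f μ ≤ ENNReal.ofReal ε), strategyCost c μ

/-! ### Randomized oracle programs with a step count

Programs are WHILE programs over binary trees (pure LISP data): registers hold binary trees, and
each elementary operation on registers, each test, each coin toss and each oracle call is one step.
This model is polynomially equivalent to (randomized, oracle) Turing machines. -/

inductive Data : Type
  | nil : Data
  | cons (a b : Data) : Data

namespace Data

def head : Data → Data
  | nil => nil
  | cons a _ => a

def tail : Data → Data
  | nil => nil
  | cons _ b => b

/-- Truth value: `nil` is false, everything else is true. -/
def truth : Data → Bool
  | nil => false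
  | cons _ _ => true

def bit : Bool → Data
  | false => nil
  | true => cons nil nil

/-- Numbers are written in unary. -/
def num : ℕ → Data
  | 0 => nil
  | k + 1 => cons nil (num k)

/-- The length of a list; it inverts `num`. -/
def length : Data → ℕ
  | nil => 0
  | cons _ b => b.length + 1

/-- The entry with index `k` of a list (`nil` beyond its end). -/
def get : Data → ℕ → Data
  | d, 0 => d.head
  | d, k + 1 => d.tail.get k

/-- A positive rational number, as numerator and denominator. -/
def rat (q : ℚ) : Data := cons (num q.num.toNat) (num q.den)

/-- The point of the cube that a list of bits denotes. -/
def point (n : ℕ) (d : Data) : Fin n → Bool := fun i => (d.get i).truth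

end Data

/-- A decision tree as program output. -/
def DTree.encode {n : ℕ} : DTree n → Data
  | .leaf b => .cons (.num 0) (.bit b)
  | .node i l r => .cons (.num (i + 1)) (.cons l.encode r.encode)

/-- Programs that may call the oracles named by the elements of `Q`. Registers are numbered. -/
inductive Prog (Q : Type) : Type
  | skip : Prog Q
  | setNil (v : ℕ) : Prog Q
  | copy (v a : ℕ) : Prog Q
  | cons (v a b : ℕ) : Prog Q
  | head (v a : ℕ) : Prog Q
  | tail (v a : ℕ) : Prog Q
  | coin (v : ℕ) : Prog Q
  | query (q : Q) (v a : ℕ) : Prog Q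
  | seq (P P' : Prog Q) : Prog Q
  | ite (a : ℕ) (P P' : Prog Q) : Prog Q
  | while (a : ℕ) (P : Prog Q) : Prog Q

/-- The contents of the registers, the number of coins tossed so far, and the oracle calls made
so far (latest first). The log is not accessible to the program. -/
structure State (Q : Type) : Type where
  mem : ℕ → Data
  coins : ℕ
  log : List (Q × Data)

namespace State

variable {Q : Type}

def write (s : State Q) (v : ℕ) (d : Data) : State Q :=
  { s with mem := Function.update s.mem v d }

/-- The initial state: the input is in register `0`. -/
def init (input : Data) : State Q :=
  { mem := fun v => if v = 0 then input else Data.nil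
    coins := 0
    log := [] }

/-- The output is read from register `0`. -/
def output (s : State Q) : Data := s.mem 0

end State

/-- `Exec ans ω P s t s'`: when the oracles answer according to `ans` and the coin tosses come out
as `ω 0, ω 1, …`, the program `P` started in state `s` halts after exactly `t` steps in state
`s'`. -/
inductive Exec {Q : Type} (ans : Q → Data → Data) (ω : ℕ → Bool) :
    Prog Q → State Q → ℕ → State Q → Prop
  | skip (s) : Exec ans ω .skip s 1 s
  | setNil (v s) : Exec ans ω (.setNil v) s 1 (s.write v .nil)
  | copy (v a s) : Exec ans ω (.copy v a) s 1 (s.write v (s.mem a))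
  | cons (v a b s) : Exec ans ω (.cons v a b) s 1 (s.write v (.cons (s.mem a) (s.mem b)))
  | head (v a s) : Exec ans ω (.head v a) s 1 (s.write v (s.mem a).head)
  | tail (v a s) : Exec ans ω (.tail v a) s 1 (s.write v (s.mem a).tail)
  | coin (v s) : Exec ans ω (.coin v) s 1
      { s.write v (.bit (ω s.coins)) with coins := s.coins + 1 }
  | query (q v a s) : Exec ans ω (.query q v a) s 1
      { s.write v (ans q (s.mem a)) with log := (q, s.mem a) :: s.log }
  | seq {P P' s s' s'' t t'} : Exec ans ω P s t s' → Exec ans ω P' s' t' s'' →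
      Exec ans ω (.seq P P') s (t + t') s''
  | ite_true {a P P' s s' t} : (s.mem a).truth = true → Exec ans ω P s t s' →
      Exec ans ω (.ite a P P') s (t + 1) s'
  | ite_false {a P P' s s' t} : (s.mem a).truth = false → Exec ans ω P' s t s' →
      Exec ans ω (.ite a P P') s (t + 1) s'
  | while_true {a P s s' s'' t t'} : (s.mem a).truth = true → Exec ans ω P s t s' →
      Exec ans ω (.while a P) s' t' s'' → Exec ans ω (.while a P) s (t + t' + 1) s''
  | while_false {a P s} : (s.mem a).truth = false → Exec ans ω (.while a P) s 1 s

/-- The law of an infinite sequence of independent fair coin tosses. -/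
def coinLaw : MeasureTheory.Measure (ℕ → Bool) :=
  MeasureTheory.Measure.infinitePi fun _ => (PMF.uniformOfFintype Bool).toMeasure

/-! ### Efficient blackbox strategies -/

/-- A blackbox strategy may evaluate `f` at points of its choice (`blackbox`), which is free of
charge but takes time, and may reveal coordinates of the unknown input (`input`), for which it
pays. -/
inductive StrategyOracle : Type
  | blackbox : StrategyOracle
  | input : StrategyOracle

def strategyAnswer {n : ℕ} (f : BoolFn n) (x : Fin n → Bool) : StrategyOracle → Data → Data
  | .blackbox, d => .bit (f (d.point n))
  | .input, d => if h : d.length < n then .bit (x ⟨d.length, h⟩) else .nil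

open Classical in
/-- The coordinates of the unknown input that have been revealed. -/
def revealed (n : ℕ) (s : State StrategyOracle) : Finset (Fin n) :=
  Finset.univ.filter fun i => ∃ d, (StrategyOracle.input, d) ∈ s.log ∧ d.length = i

/-- The input of a strategy in the unit-cost setting: the dimension and the error parameter. -/
def strategyInput (n : ℕ) (ε : ℚ) : Data := .cons (.num n) (.rat ε)

/-- In the unit-cost setting, the program `S`, which accesses `f` only as a blackbox, is an
efficient randomized `(C * ε)`-error strategy of expected cost
`max 1 (opt f 1 ε) * o_ε (totalInfluence f)`, for all functions `f` of `n` variables that are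
computable by decision trees of size at most `n ^ k + k`. Here `final x ω` is the state in which
`S` halts on the unknown input `x` with coins `ω`. -/
def IsEfficientStrategy (S : Prog StrategyOracle) (C : ℝ) (k : ℕ) : Prop :=
  ∀ ε : ℚ, 0 < ε → ε < 1 / 2 →
    ∃ (p : Polynomial ℕ) (g : ℝ → ℝ),
      g =o[Filter.atTop] (fun u : ℝ => u) ∧
      (∀ b : ℝ, BddAbove (g '' Set.Icc 0 b)) ∧
      ∀ (n : ℕ) (f : BoolFn n), HasTreeOfSize f (n ^ k + k) →
        ∃ final : (Fin n → Bool) → (ℕ → Bool) → State StrategyOracle,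
          (∀ x ω, ∃ t ≤ p.eval n,
            Exec (strategyAnswer f x) ω S (State.init (strategyInput n ε)) t (final x ω)) ∧
          (∑ x, coinLaw {ω | (final x ω).output.truth ≠ f x}) / 2 ^ n
            ≤ ENNReal.ofReal (C * ε) ∧
          (∑ x, ∫⁻ ω, ((revealed n (final x ω)).card : ℝ≥0∞) ∂coinLaw) / 2 ^ n
            ≤ max 1 (opt f (fun _ => 1) ε) * ENNReal.ofReal (g (totalInfluence f))

/-! ### Proper learning of decision trees -/

/-- A learner with query access to the target `f` has one oracle. -/
def learnerAnswer {n : ℕ} (f : BoolFn n) : Unit → Data → Data :=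
  fun _ d => .bit (f (d.point n))

/-- The input of a learner: dimension, accuracy and confidence parameters. -/
def learnerInput (n : ℕ) (ε δ : ℚ) : Data := .cons (.num n) (.cons (.rat ε) (.rat δ))

/-- The learner `L`, run on the target `f` with coins `ω`, halts within `T` steps and its output
is a decision tree hypothesis, of size at most `T`, that is `ε`-close to `f` under the uniform
distribution. -/
def LearnsWithin {n : ℕ} (L : Prog Unit) (f : BoolFn n) (ε δ : ℚ) (T : ℕ) (ω : ℕ → Bool) : Prop :=
  ∃ t ≤ T, ∃ (s : State Unit) (h : DTree n),
    Exec (learnerAnswer f) ω L (State.init (learnerInput n ε δ)) t s ∧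
    s.output = h.encode ∧ h.size ≤ T ∧ disagreement h.eval f ≤ ε

/-- `L` properly PAC learns decision trees of size `n ^ k + k` under the uniform distribution,
with queries, in time `n ^ o(log n)` for all fixed accuracy and confidence parameters. -/
def ProperlyLearnsTrees (L : Prog Unit) (k : ℕ) : Prop :=
  ∀ ε δ : ℚ, 0 < ε → ε < 1 → 0 < δ → δ < 1 →
    ∃ (T : ℕ → ℕ) (r : ℕ → ℝ),
      r =o[Filter.atTop] (fun n : ℕ => Real.log n) ∧
      (∀ᶠ n : ℕ in Filter.atTop, (T n : ℝ) ≤ (n : ℝ) ^ r n) ∧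
      ∀ (n : ℕ) (f : BoolFn n), HasTreeOfSize f (n ^ k + k) →
        ENNReal.ofReal (1 - δ) ≤ coinLaw {ω | LearnsWithin L f ε δ (T n) ω}

end PricedQuery

end

open scoped ENNReal Topology Asymptotics

noncomputable section

namespace PricedQuery

set_option linter.unusedSimpArgs false

/-! ### Average depth of decision trees -/

section Trees

variable {n : ℕ}

/-! A tree with `s` leaves, stripped of repeated queries, makes at most `log₂ s` queries on average,
and this average bounds both the optimal cost and the total influence
(`exists_average_depth_bound`). For `s = n ^ k + k` both are `O(log n)`, so for a fixed error
parameter the strategy may spend only `O(log n) * o(log n) = o(log² n)` queries in expectation.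
Since the influence is known only from above, `g` is first replaced by a running supremum
(`exists_monotone_majorant`).

Once its coins are fixed, the strategy is itself a decision tree, and query access to `f` suffices
to write that tree down. Run the strategy on a partial assignment completed by zeros. The first
unset coordinate that it asks for is the same for every input consistent with the assignment
(`Exec.compare`), hence it is the next node, and both of its values are explored. Cut at depth `d`,
the tree has at most `2 ^ d` leaves.

Markov's inequality is used twice. Over the coins (`coinLaw_good`): with probability at least `1 -
δ` the strategy with fixed coins has error below `ε / 2` and average cost `o(log² n)`. Over the
inputs (`truncCount_mul_lt`): if `d` is at least `M` times this average cost, fewer than a `1 / M`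
fraction of the inputs is truncated. So some `d = o(log² n)` suffices, and time `4 ^ d * poly(n)` is
`n ^ o(log n)` (`exists_exponent`).

One program must serve all `k`, without knowing `p` or `g`, so it cannot compute `d`. But every
truncated leaf lies at depth exactly `d` and has weight `2⁻ᵈ` (`card_truncated`), so counting leaves
gives the truncated fraction exactly. The learner tries `d = 0, 1, 2, …` until that fraction is
below `1 / M`. The strategy gets error parameter `1 / M`, where `M` is a constant multiple of the
denominators of `ε` and `δ`.

The remaining work is the implementation: `wp_simulate` replays recorded coins, so that all runs
belong to one tree, and `wp_learner` bounds the time. -/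

/-- Flip the `i`-th bit. -/
def flipBit (i : Fin n) (x : Fin n → Bool) : Fin n → Bool := Function.update x i (!x i)

lemma flipBit_involutive (i : Fin n) : Function.Involutive (flipBit i) := by
  intro x
  simp [flipBit]

lemma flipBit_same (i : Fin n) (x : Fin n → Bool) : flipBit i x i = !x i := by simp [flipBit]

lemma flipBit_ne {i j : Fin n} (h : j ≠ i) (x : Fin n → Bool) : flipBit i x j = x j := by
  simp [flipBit, h]

lemma sum_flipBit {M : Type*} [AddCommMonoid M] (i : Fin n) (F : (Fin n → Bool) → M) :
    ∑ x, F (flipBit i x) = ∑ x, F x :=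
  Equiv.sum_comp (flipBit_involutive i).toPerm F

/-- Pair each `x` with its flip at `i`: one of the two contributes `A`, the other `B`, and neither
value depends on the flipped bit. -/
lemma two_mul_sum_ite (i : Fin n) (A B : (Fin n → Bool) → ℕ)
    (hA : ∀ x, A (flipBit i x) = A x) (hB : ∀ x, B (flipBit i x) = B x) :
    2 * ∑ x, (if x i then A x else B x) = ∑ x, A x + ∑ x, B x := by
  have h := sum_flipBit i fun x => if x i then A x else B x
  rw [two_mul]
  nth_rw 1 [← h]
  rw [← Finset.sum_add_distrib, ← Finset.sum_add_distrib]
  refine Finset.sum_congr rfl fun x _ => ?_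
  simp only [flipBit_same, hA, hB]
  cases x i <;> simp [add_comm]

namespace DTree

/-- The restriction of a tree to a subcube: coordinates fixed by `ρ` are no longer queried. -/
def prune : DTree n → (Fin n → Option Bool) → DTree n
  | leaf b, _ => leaf b
  | node i l r, ρ =>
    match ρ i with
    | some b => if b then r.prune ρ else l.prune ρ
    | none => node i (l.prune (Function.update ρ i (some false)))
        (r.prune (Function.update ρ i (some true)))

lemma eval_prune (t : DTree n) : ∀ (ρ : Fin n → Option Bool) (x : Fin n → Bool),
    (∀ i b, ρ i = some b → x i = b) → (t.prune ρ).eval x = t.eval x := by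
  induction t with
  | leaf b => intros; rfl
  | node i l r hl hr =>
    intro ρ x h
    rcases hρ : ρ i with _ | b
    · have key : ∀ c, x i = c → ∀ j b, Function.update ρ i (some c) j = some b → x j = b := by
        intro c hc j b hj
        by_cases hji : j = i
        · subst hji; simpa [hc] using hj
        · exact h j b (by simpa [hji] using hj)
      simp only [prune, hρ, eval]
      cases hx : x i
      · simpa using hl _ x (key _ hx)
      · simpa using hr _ x (key _ hx)
    · have := h i b hρ
      cases b <;> simp [prune, hρ, eval, this, hl ρ x h, hr ρ x h]

/-- A pruned tree never queries a coordinate that `ρ` fixes. This makes the costs of the two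
subtrees independent of the bit read at their parent. -/
lemma cost_prune_flipBit (c : Fin n → ℕ) (t : DTree n) :
    ∀ (ρ : Fin n → Option Bool) (j : Fin n) (x : Fin n → Bool), (ρ j).isSome →
      (t.prune ρ).cost c (flipBit j x) = (t.prune ρ).cost c x := by
  induction t with
  | leaf b => intros; rfl
  | node i l r hl hr =>
    intro ρ j x h
    rcases hρ : ρ i with _ | b
    · have hji : j ≠ i := by rintro rfl; simp [hρ] at h
      have h' : ∀ b : Bool, (Function.update ρ i (some b) j).isSome := by simpa [hji] using h
      simp only [prune, hρ, cost, flipBit_ne hji.symm, hl _ j x (h' false), hr _ j x (h' true)]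
    · cases b <;> simp [prune, hρ, hl ρ j x h, hr ρ j x h]

lemma one_le_size (t : DTree n) : 1 ≤ t.size := by
  induction t with
  | leaf b => exact le_rfl
  | node i l r hl hr => simp only [size]; omega

/-- The inequality `4ab ≤ (a + b)²` in logarithmic form; it is the inductive step of the bound on
the average depth. -/
lemma logb_add_logb_le {a b : ℝ} (ha : 0 < a) (hb : 0 < b) :
    1 + (Real.logb 2 a + Real.logb 2 b) / 2 ≤ Real.logb 2 (a + b) := by
  have h4 : Real.logb 2 4 = 2 := by
    rw [show (4 : ℝ) = 2 ^ (2 : ℝ) by norm_num, Real.logb_rpow] <;> norm_num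
  have h : Real.logb 2 (4 * (a * b)) ≤ Real.logb 2 ((a + b) ^ 2) :=
    Real.logb_le_logb_of_le (by norm_num) (by positivity) (by nlinarith [sq_nonneg (a - b)])
  rw [Real.logb_mul (by norm_num) (by positivity), Real.logb_mul ha.ne' hb.ne', h4,
    Real.logb_pow] at h
  push_cast at h
  linarith

/-- A node costs one query plus the mean of the costs of its subtrees, and `logb_add_logb_le`
absorbs this. The average is the true mean of the two only because pruning removes repeated queries,
hence the induction over all `ρ`. The factor `2 ^ n` clears the denominator. -/
lemma sum_cost_prune_le (t : DTree n) : ∀ ρ : Fin n → Option Bool,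
    ((∑ x, (t.prune ρ).cost (fun _ => 1) x : ℕ) : ℝ) ≤ 2 ^ n * Real.logb 2 t.size := by
  induction t with
  | leaf b => intro ρ; simp [prune, cost, size]
  | node i l r hl hr =>
    intro ρ
    have hlp : (0 : ℝ) < l.size := by exact_mod_cast l.one_le_size
    have hrp : (0 : ℝ) < r.size := by exact_mod_cast r.one_le_size
    have hsz : ((node i l r).size : ℝ) = l.size + r.size := by simp [size]
    rcases hρ : ρ i with _ | b
    · set A := r.prune (Function.update ρ i (some true)) with hA
      set B := l.prune (Function.update ρ i (some false)) with hB
      have e : ∑ x, ((node i l r).prune ρ).cost (fun _ => 1) x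
          = 2 ^ n + ∑ x : Fin n → Bool,
            (if x i then A.cost (fun _ => 1) x else B.cost (fun _ => 1) x) := by
        simp only [prune, hρ, cost, ← hA, ← hB]
        rw [Finset.sum_add_distrib]
        simp
      have h2 := two_mul_sum_ite i (A.cost fun _ => 1) (B.cost fun _ => 1)
        (fun x => cost_prune_flipBit _ r _ i x (by simp))
        (fun x => cost_prune_flipBit _ l _ i x (by simp))
      have h2' : (2 : ℝ) * ((∑ x : Fin n → Bool,
          (if x i then A.cost (fun _ => 1) x else B.cost (fun _ => 1) x) : ℕ) : ℝ)
          = ((∑ x, A.cost (fun _ => 1) x : ℕ) : ℝ) + ((∑ x, B.cost (fun _ => 1) x : ℕ) : ℝ) := by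
        exact_mod_cast h2
      rw [e, hsz]
      push_cast at h2' ⊢
      have h3 := hr (Function.update ρ i (some true))
      have h4 := hl (Function.update ρ i (some false))
      push_cast at h3 h4
      have h5 := mul_le_mul_of_nonneg_left (logb_add_logb_le hlp hrp)
        (show (0 : ℝ) ≤ 2 ^ n by positivity)
      linarith
    · have hle : ∀ {a : ℝ}, 0 < a → a ≤ l.size + r.size →
          2 ^ n * Real.logb 2 a ≤ 2 ^ n * Real.logb 2 (node i l r).size := by
        intro a ha h
        rw [hsz]
        exact mul_le_mul_of_nonneg_left
          (Real.logb_le_logb_of_le (by norm_num) ha h) (by positivity)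
      cases b
      · simpa [prune, hρ] using (hl ρ).trans (hle hlp (by linarith))
      · simpa [prune, hρ] using (hr ρ).trans (hle hrp (by linarith))

/-- The number of sensitive coordinates at `x` is at most the number of queries made on `x`. -/
lemma card_sensitive_le_cost (t : DTree n) (x : Fin n → Bool) :
    (Finset.univ.filter fun i => t.eval (flipBit i x) ≠ t.eval x).card
      ≤ t.cost (fun _ => 1) x := by
  induction t with
  | leaf b => simp [eval]
  | node i l r hl hr =>
    -- The subtree `u` on the path of `x` also serves every flip of `x` away from `i`, so the root
    -- adds at most the coordinate `i` to the sensitive ones.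
    have key : ∀ u : DTree n, (∀ j, j ≠ i → (node i l r).eval (flipBit j x) = u.eval (flipBit j x)) →
        (node i l r).eval x = u.eval x →
        (Finset.univ.filter fun j => (node i l r).eval (flipBit j x) ≠ (node i l r).eval x).card
          ≤ 1 + (Finset.univ.filter fun j => u.eval (flipBit j x) ≠ u.eval x).card := by
      intro u h1 h2
      rw [add_comm]
      refine le_trans (Finset.card_le_card ?_) (Finset.card_insert_le i _)
      intro j hj
      by_cases hji : j = i
      · simp [hji]
      · simp only [Finset.mem_filter, Finset.mem_univ, true_and, Finset.mem_insert, hji,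
          false_or] at hj ⊢
        rwa [h1 j hji, h2] at hj
    cases hx : x i
    · refine (key l (fun j hj => ?_) ?_).trans ?_
      · simp [eval, flipBit_ne hj.symm, hx]
      · simp [eval, hx]
      · simpa [cost, hx] using hl
    · refine (key r (fun j hj => ?_) ?_).trans ?_
      · simp [eval, flipBit_ne hj.symm, hx]
      · simp [eval, hx]
      · simpa [cost, hx] using hr

end DTree

/-- Double counting of sensitive pairs `(i, x)`: the total influence is the average sensitivity, and
sensitivity is at most depth pointwise. -/
lemma totalInfluence_le_of_tree {f : BoolFn n} (t : DTree n) (ht : ∀ x, t.eval x = f x) :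
    totalInfluence f ≤ ((∑ x, t.cost (fun _ => 1) x : ℕ) : ℝ) / 2 ^ n := by
  unfold totalInfluence influence disagreement
  rw [← Finset.sum_div]
  refine div_le_div_of_nonneg_right ?_ (by positivity)
  have : ∑ i, (Finset.univ.filter fun x : Fin n → Bool => f (flipBit i x) ≠ f x).card
      ≤ ∑ x, t.cost (fun _ => 1) x := by
    simp only [Finset.card_filter]
    rw [Finset.sum_comm]
    refine Finset.sum_le_sum fun x _ => ?_
    have := t.card_sensitive_le_cost x
    simpa only [Finset.card_filter, ht] using this
  exact_mod_cast this

lemma totalInfluence_nonneg (f : BoolFn n) : 0 ≤ totalInfluence f :=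
  Finset.sum_nonneg fun _ _ => div_nonneg (Nat.cast_nonneg _) (by positivity)

lemma opt_le_of_tree {f : BoolFn n} (c : Fin n → ℕ) {ε : ℝ} (t : DTree n)
    (ht : ∀ x, t.eval x = f x) :
    opt f c ε ≤ (∑ x, (t.cost c x : ℝ≥0∞)) / 2 ^ n := by
  have hsum : ∀ F : DTree n → ℝ≥0∞, ∑' u, PMF.pure t u * F u = F t := by
    intro F
    rw [tsum_eq_single t]
    · simp
    · intro u hu
      simp [PMF.pure_apply, hu]
  refine (iInf₂_le (PMF.pure t) ?_).trans (le_of_eq (hsum _))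
  rw [strategyError, hsum]
  simp [disagreement, ht]

/-- A function with a small tree has small optimal cost and small total influence. -/
lemma exists_average_depth_bound {f : BoolFn n} {s : ℕ} (h : HasTreeOfSize f s) (ε : ℝ) :
    opt f (fun _ => 1) ε ≤ ENNReal.ofReal (Real.logb 2 s) ∧
      totalInfluence f ≤ Real.logb 2 s := by
  obtain ⟨t, hts, ht⟩ := h
  have hev : ∀ x, (t.prune fun _ => none).eval x = f x := fun x => by
    rw [t.eval_prune _ x (by simp), ht]
  have h1 : (0 : ℝ) < t.size := by exact_mod_cast t.one_le_size
  have hb : ((∑ x, (t.prune fun _ => none).cost (fun _ => 1) x : ℕ) : ℝ) / 2 ^ n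
      ≤ Real.logb 2 s := by
    rw [div_le_iff₀ (by positivity), mul_comm]
    refine (t.sum_cost_prune_le _).trans (mul_le_mul_of_nonneg_left ?_ (by positivity))
    exact Real.logb_le_logb_of_le (by norm_num) h1 (by exact_mod_cast hts)
  refine ⟨(opt_le_of_tree _ _ hev).trans ?_, (totalInfluence_le_of_tree _ hev).trans hb⟩
  refine le_trans (le_of_eq ?_) (ENNReal.ofReal_le_ofReal hb)
  rw [ENNReal.ofReal_div_of_pos (by positivity), ENNReal.ofReal_natCast,
    ENNReal.ofReal_pow (by norm_num)]
  simp

end Trees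

/-! ### Executions -/

section Executions

variable {Q : Type} {ans : Q → Data → Data} {ω : ℕ → Bool}

/-- Once answers and coins are fixed, execution is deterministic. The exact rules for `WP` and the
comparison of runs rest on this. -/
lemma Exec.unique {P : Prog Q} {s s₁ : State Q} {t₁ : ℕ} (h : Exec ans ω P s t₁ s₁) :
    ∀ {t₂ : ℕ} {s₂ : State Q}, Exec ans ω P s t₂ s₂ → t₁ = t₂ ∧ s₁ = s₂ := by
  induction h with
  | seq _ _ ih ih' =>
    rintro _ _ (_ | _ | _ | _ | _ | _ | _ | _ | ⟨h₁, h₂⟩)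
    obtain ⟨rfl, rfl⟩ := ih h₁
    obtain ⟨rfl, rfl⟩ := ih' h₂
    exact ⟨rfl, rfl⟩
  | ite_true ha _ ih =>
    intro _ _ h
    cases h with
    | ite_true _ h => obtain ⟨rfl, rfl⟩ := ih h; exact ⟨rfl, rfl⟩
    | ite_false hb _ => simp [ha] at hb
  | ite_false ha _ ih =>
    intro _ _ h
    cases h with
    | ite_true hb _ => simp [ha] at hb
    | ite_false _ h => obtain ⟨rfl, rfl⟩ := ih h; exact ⟨rfl, rfl⟩
  | while_true ha _ _ ih ih' =>
    intro _ _ h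
    cases h with
    | while_true _ h₁ h₂ =>
      obtain ⟨rfl, rfl⟩ := ih h₁
      obtain ⟨rfl, rfl⟩ := ih' h₂
      exact ⟨rfl, rfl⟩
    | while_false hb => simp [ha] at hb
  | while_false ha =>
    intro _ _ h
    cases h with
    | while_true hb _ _ => simp [ha] at hb
    | while_false _ => exact ⟨rfl, rfl⟩
  | _ => intro _ _ h; cases h; exact ⟨rfl, rfl⟩

lemma Exec.coins_le {P : Prog Q} {s s' : State Q} {t : ℕ} (h : Exec ans ω P s t s') :
    s.coins ≤ s'.coins ∧ s'.coins ≤ s.coins + t := by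
  induction h <;> (try simp only [State.write]) <;> omega

/-- A run sees only the coins it tosses. With a time bound it depends on a finite prefix of `ω`,
which yields measurability. -/
lemma Exec.congr_coins {P : Prog Q} {s s' : State Q} {t : ℕ} (h : Exec ans ω P s t s')
    {ω' : ℕ → Bool} (hω : ∀ i < s'.coins, ω' i = ω i) : Exec ans ω' P s t s' := by
  induction h with
  | coin v s =>
    have := hω s.coins (by simp)
    rw [← this]
    exact Exec.coin v s
  | skip s => exact .skip s
  | setNil v s => exact .setNil v s
  | copy v a s => exact .copy v a s
  | cons v a b s => exact .cons v a b s
  | head v a s => exact .head v a s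
  | tail v a s => exact .tail v a s
  | query q v a s => exact .query q v a s
  | seq _ h₂ ih ih' =>
    exact .seq (ih fun i hi => hω i (hi.trans_le h₂.coins_le.1)) (ih' hω)
  | ite_true ha _ ih => exact .ite_true ha (ih hω)
  | ite_false ha _ ih => exact .ite_false ha (ih hω)
  | while_true ha _ h₂ ih ih' =>
    exact .while_true ha (ih fun i hi => hω i (hi.trans_le h₂.coins_le.1)) (ih' hω)
  | while_false ha => exact .while_false ha

/-- All registers that a program writes to have numbers below this bound. -/
def Prog.regBound : Prog Q → ℕ
  | .skip => 0
  | .setNil v => v + 1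
  | .copy v _ => v + 1
  | .cons v _ _ => v + 1
  | .head v _ => v + 1
  | .tail v _ => v + 1
  | .coin v => v + 1
  | .query _ v _ => v + 1
  | .seq P P' => max P.regBound P'.regBound
  | .ite _ P P' => max P.regBound P'.regBound
  | .while _ P => P.regBound

/-- Registers above the bound keep their initial value, so clearing finitely many registers restores
the initial memory between runs. -/
lemma Exec.mem_eq_of_regBound_le {P : Prog Q} {s s' : State Q} {t : ℕ}
    (h : Exec ans ω P s t s') {v : ℕ} (hv : P.regBound ≤ v) : s'.mem v = s.mem v := by
  induction h with
  | skip s => rfl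
  | seq _ _ ih ih' =>
    simp only [Prog.regBound, max_le_iff] at hv
    rw [ih' hv.2, ih hv.1]
  | ite_true _ _ ih => simp only [Prog.regBound, max_le_iff] at hv; exact ih hv.1
  | ite_false _ _ ih => simp only [Prog.regBound, max_le_iff] at hv; exact ih hv.2
  | while_true _ _ _ ih ih' => rw [ih' hv, ih hv]
  | while_false _ => rfl
  | _ =>
    simp only [Prog.regBound] at hv
    simp only [State.write]
    rw [Function.update_of_ne (by omega)]

/-- The height of a binary tree. -/
def Data.height : Data → ℕ
  | .nil => 0
  | .cons a b => max a.height b.height + 1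

lemma Data.length_le_height (d : Data) : d.length ≤ d.height := by
  induction d with
  | nil => rfl
  | cons a b _ ih => simp only [length, height]; omega

lemma Data.height_head_le (d : Data) : d.head.height ≤ d.height := by
  cases d <;> simp only [head, height] <;> omega

lemma Data.height_tail_le (d : Data) : d.tail.height ≤ d.height := by
  cases d <;> simp only [tail, height] <;> omega

lemma Data.height_bit_le (b : Bool) : (Data.bit b).height ≤ 1 := by
  cases b <;> simp [bit, height]

lemma Data.height_num (k : ℕ) : (Data.num k).height = k := by
  induction k with
  | zero => rfl
  | succ k ih => simp [num, height, ih]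

/-- Each step raises the largest height by at most one. Height bounds the length of a query
argument, hence the time to look a coordinate up. -/
lemma Exec.height_le {P : Prog Q} {s s' : State Q} {t : ℕ} (h : Exec ans ω P s t s')
    (hans : ∀ q d, (ans q d).height ≤ 1) :
    ∀ {B : ℕ}, (∀ v, (s.mem v).height ≤ B) → ∀ v, (s'.mem v).height ≤ B + t := by
  have upd : ∀ {s : State Q} {B v : ℕ} {d : Data}, (∀ v, (s.mem v).height ≤ B) →
      d.height ≤ B + 1 → ∀ w, (Function.update s.mem v d w).height ≤ B + 1 := by
    intro s B v d h hd w
    by_cases hw : w = v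
    · subst hw; simpa using hd
    · simpa [hw] using (h w).trans (Nat.le_succ B)
  induction h with
  | skip s => intro B h v; exact (h v).trans (Nat.le_succ B)
  | setNil v s => intro B h; exact upd h (by simp [Data.height])
  | copy v a s => intro B h; exact upd h ((h a).trans (Nat.le_succ B))
  | cons v a b s =>
    intro B h
    refine upd h ?_
    have := h a
    have := h b
    simp only [Data.height]; omega
  | head v a s =>
    intro B h; exact upd h ((Data.height_head_le _).trans ((h a).trans (Nat.le_succ B)))
  | tail v a s =>
    intro B h; exact upd h ((Data.height_tail_le _).trans ((h a).trans (Nat.le_succ B)))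
  | coin v s => intro B h; exact upd h ((Data.height_bit_le _).trans (by omega))
  | query q v a s => intro B h; exact upd h ((hans _ _).trans (by omega))
  | seq _ _ ih ih' => intro B h; rw [← add_assoc]; exact ih' (ih h)
  | ite_true _ _ ih => intro B h v; exact (ih h v).trans (by omega)
  | ite_false _ _ ih => intro B h v; exact (ih h v).trans (by omega)
  | while_true _ _ _ ih ih' => intro B h v; exact (ih' (ih h) v).trans (by omega)
  | while_false _ => intro B h v; exact (h v).trans (by omega)

end Executions

/-! ### Runs of a strategy on partially specified inputs -/

section Partial

variable {n : ℕ}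

/-- A partial assignment, completed by zeros. -/
def fill (ρ : Fin n → Option Bool) : Fin n → Bool := fun i => (ρ i).getD false

def Consistent (ρ : Fin n → Option Bool) (x : Fin n → Bool) : Prop :=
  ∀ i b, ρ i = some b → x i = b

/-- The unspecified coordinate that an oracle call asks for, if any. -/
def unsetQuery (ρ : Fin n → Option Bool) : StrategyOracle → Data → Option (Fin n)
  | .blackbox, _ => none
  | .input, d => if h : d.length < n then
      (if ρ ⟨d.length, h⟩ = none then some ⟨d.length, h⟩ else none) else none

/-- The first unspecified coordinate asked for in a log. -/
def firstUnset (ρ : Fin n → Option Bool) : List (StrategyOracle × Data) → Option (Fin n)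
  | [] => none
  -- The log is latest first, so earlier calls, in the tail, take precedence.
  | e :: l => (firstUnset ρ l).or (unsetQuery ρ e.1 e.2)

lemma eq_none_of_unsetQuery {ρ : Fin n → Option Bool} {q : StrategyOracle} {d : Data} {i : Fin n}
    (h : unsetQuery ρ q d = some i) : ρ i = none ∧ q = .input ∧ d.length = i := by
  cases q
  · simp [unsetQuery] at h
  · simp only [unsetQuery] at h
    split_ifs at h with h₁ h₂
    cases h
    exact ⟨h₂, rfl, rfl⟩

lemma firstUnset_spec {ρ : Fin n → Option Bool} {l : List (StrategyOracle × Data)} {i : Fin n}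
    (h : firstUnset ρ l = some i) :
    ρ i = none ∧ ∃ d, (StrategyOracle.input, d) ∈ l ∧ d.length = i := by
  induction l with
  | nil => simp [firstUnset] at h
  | cons e l ih =>
    obtain ⟨q, d⟩ := e
    rw [firstUnset, Option.or_eq_some_iff] at h
    rcases h with h | ⟨-, h⟩
    · obtain ⟨h₁, d', h₂, h₃⟩ := ih h
      exact ⟨h₁, d', List.mem_cons_of_mem _ h₂, h₃⟩
    · obtain ⟨h₁, h₂, h₃⟩ := eq_none_of_unsetQuery h
      simp only at h₂
      subst h₂
      exact ⟨h₁, d, List.mem_cons_self .., h₃⟩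

lemma mem_revealed_of_firstUnset {ρ : Fin n → Option Bool} {s : State StrategyOracle} {i : Fin n}
    (h : firstUnset ρ s.log = some i) : i ∈ revealed n s := by
  simpa [revealed] using (firstUnset_spec h).2

lemma strategyAnswer_congr {f : BoolFn n} {ρ : Fin n → Option Bool} {x y : Fin n → Bool}
    (hx : Consistent ρ x) (hy : Consistent ρ y) {q : StrategyOracle} {d : Data}
    (h : unsetQuery ρ q d = none) : strategyAnswer f x q d = strategyAnswer f y q d := by
  cases q
  · rfl
  · simp only [strategyAnswer]
    split_ifs with hd
    · rcases hρ : ρ ⟨d.length, hd⟩ with _ | b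
      · simp [unsetQuery, hd, hρ] at h
      · rw [hx _ b hρ, hy _ b hρ]
    · rfl

lemma Exec.firstUnset_mono {ans : StrategyOracle → Data → Data} {ω : ℕ → Bool}
    {P : Prog StrategyOracle} {s s' : State StrategyOracle} {t : ℕ} (h : Exec ans ω P s t s')
    {ρ : Fin n → Option Bool} {i : Fin n} (hi : firstUnset ρ s.log = some i) :
    firstUnset ρ s'.log = some i := by
  induction h <;> simp_all [State.write, firstUnset]

/-- Two runs whose oracles agree on the specified coordinates are equal or ask for the same
unspecified coordinate first. -/
lemma Exec.compare {a a' : StrategyOracle → Data → Data} {ω : ℕ → Bool}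
    {ρ : Fin n → Option Bool} (haa : ∀ q d, unsetQuery ρ q d = none → a q d = a' q d)
    {P : Prog StrategyOracle} {s s₁ : State StrategyOracle} {t₁ : ℕ} (h : Exec a ω P s t₁ s₁) :
    ∀ {t₂ : ℕ} {s₂ : State StrategyOracle}, Exec a' ω P s t₂ s₂ → firstUnset ρ s.log = none →
      (s₁ = s₂ ∧ firstUnset ρ s₁.log = none) ∨
        ∃ i, firstUnset ρ s₁.log = some i ∧ firstUnset ρ s₂.log = some i := by
  induction h with
  | query q v x s =>
    intro _ _ h hs
    cases h
    -- Either the call concerns no unset coordinate and the runs stay in step, or they may part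
    -- here, with the same coordinate entered first in both logs; later calls cannot displace it.
    rcases hq : unsetQuery ρ q (s.mem x) with _ | i
    · left
      rw [haa _ _ hq]
      exact ⟨rfl, by simp [firstUnset, hs, hq]⟩
    · right
      exact ⟨i, by simp [firstUnset, hs, hq], by simp [firstUnset, hs, hq]⟩
  | seq _ e₂ ih ih' =>
    rintro _ _ (_ | _ | _ | _ | _ | _ | _ | _ | ⟨h₁, h₂⟩) hs
    rcases ih h₁ hs with ⟨rfl, h⟩ | ⟨i, hi, hi'⟩
    · exact ih' h₂ h
    · exact .inr ⟨i, e₂.firstUnset_mono hi, h₂.firstUnset_mono hi'⟩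
  | ite_true ha _ ih =>
    intro _ _ h hs
    cases h with
    | ite_true _ h => exact ih h hs
    | ite_false hb _ => simp [ha] at hb
  | ite_false ha _ ih =>
    intro _ _ h hs
    cases h with
    | ite_true hb _ => simp [ha] at hb
    | ite_false _ h => exact ih h hs
  | while_true ha _ e₂ ih ih' =>
    intro _ _ h hs
    cases h with
    | while_true _ h₁ h₂ =>
      rcases ih h₁ hs with ⟨rfl, h⟩ | ⟨i, hi, hi'⟩
      · exact ih' h₂ h
      · exact .inr ⟨i, e₂.firstUnset_mono hi, h₂.firstUnset_mono hi'⟩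
    | while_false hb => simp [ha] at hb
  | while_false ha =>
    intro _ _ h hs
    cases h with
    | while_true hb _ _ => simp [ha] at hb
    | while_false _ => exact .inl ⟨rfl, hs⟩
  | _ => intro _ _ h hs; cases h; exact .inl ⟨rfl, hs⟩

lemma consistent_fill (ρ : Fin n → Option Bool) : Consistent ρ (fill ρ) := by
  intro i b h
  simp [fill, h]

end Partial

/-! ### The decision tree of a strategy with fixed coins, truncated at a given depth -/

section StrategyTree

variable {n : ℕ}

/-- The first query to an unspecified coordinate in the run on the completed partial input. -/
def nextQuery (F : (Fin n → Bool) → State StrategyOracle) (ρ : Fin n → Option Bool) :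
    Option (Fin n) := firstUnset ρ (F (fill ρ)).log

/-- Here `F x` is the final state on `x` for one fixed coin sequence. A path still asking for a
coordinate at depth `0` is cut off with the arbitrary value `false`. -/
def strategyTree (F : (Fin n → Bool) → State StrategyOracle) :
    ℕ → (Fin n → Option Bool) → DTree n
  | 0, ρ =>
    match nextQuery F ρ with
    | none => .leaf (F (fill ρ)).output.truth
    | some _ => .leaf false
  | d + 1, ρ =>
    match nextQuery F ρ with
    | none => .leaf (F (fill ρ)).output.truth
    | some i => .node i (strategyTree F d (Function.update ρ i (some false)))
        (strategyTree F d (Function.update ρ i (some true)))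

/-- The number of truncated leaves. -/
def truncCount (F : (Fin n → Bool) → State StrategyOracle) : ℕ → (Fin n → Option Bool) → ℕ
  | 0, ρ => if (nextQuery F ρ).isSome then 1 else 0
  | d + 1, ρ =>
    match nextQuery F ρ with
    | none => 0
    | some i => truncCount F d (Function.update ρ i (some false)) +
        truncCount F d (Function.update ρ i (some true))

/-- The path of `x` ends in a truncated leaf. -/
def Truncated (F : (Fin n → Bool) → State StrategyOracle) (x : Fin n → Bool) :
    ℕ → (Fin n → Option Bool) → Prop
  | 0, ρ => (nextQuery F ρ).isSome
  | d + 1, ρ =>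
    match nextQuery F ρ with
    | none => False
    | some i => Truncated F x d (Function.update ρ i (some (x i)))

/-- The run on `x` is the run on any partial assignment consistent with `x`, until both ask for
the same unspecified coordinate. -/
def LocallyDetermined (F : (Fin n → Bool) → State StrategyOracle) : Prop :=
  ∀ ρ x, Consistent ρ x → (nextQuery F ρ = none ∧ F x = F (fill ρ)) ∨
    ∃ i, nextQuery F ρ = some i ∧ ρ i = none ∧ i ∈ revealed n (F x)

variable {F : (Fin n → Bool) → State StrategyOracle}

lemma size_strategyTree_le (d : ℕ) : ∀ ρ, (strategyTree F d ρ).size ≤ 2 ^ d := by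
  induction d with
  | zero => intro ρ; rw [strategyTree]; split <;> simp [DTree.size]
  | succ d ih =>
    intro ρ
    rw [strategyTree]
    split
    · simpa [DTree.size] using Nat.one_le_two_pow
    · rename_i i _
      have h₁ := ih (Function.update ρ i (some false))
      have h₂ := ih (Function.update ρ i (some true))
      simp only [DTree.size, pow_succ]
      omega

lemma truncCount_le (d : ℕ) : ∀ ρ, truncCount F d ρ ≤ 2 ^ d := by
  induction d with
  | zero => intro ρ; rw [truncCount]; split <;> simp
  | succ d ih =>
    intro ρ
    rw [truncCount]
    split
    · simp
    · rename_i i _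
      have h₁ := ih (Function.update ρ i (some false))
      have h₂ := ih (Function.update ρ i (some true))
      simp only [pow_succ]
      omega

lemma Consistent.update {ρ : Fin n → Option Bool} {x : Fin n → Bool} (h : Consistent ρ x)
    {i : Fin n} {b : Bool} (hi : x i = b) : Consistent (Function.update ρ i (some b)) x := by
  intro j c hj
  by_cases hji : j = i
  · subst hji; simpa [hi] using hj
  · exact h j c (by simpa [hji] using hj)

lemma eval_strategyTree (hF : LocallyDetermined F) (d : ℕ) :
    ∀ {ρ x}, Consistent ρ x → ¬ Truncated F x d ρ →
      (strategyTree F d ρ).eval x = (F x).output.truth := by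
  induction d with
  | zero =>
    intro ρ x hx ht
    rcases hF ρ x hx with ⟨h, h'⟩ | ⟨i, h, -⟩
    · simp [strategyTree, h, DTree.eval, h']
    · simp [Truncated, h] at ht
  | succ d ih =>
    intro ρ x hx ht
    rcases hF ρ x hx with ⟨h, h'⟩ | ⟨i, h, -⟩
    · simp [strategyTree, h, DTree.eval, h']
    · simp only [Truncated, h] at ht
      have := ih (hx.update (i := i) rfl) ht
      simp only [strategyTree, h, DTree.eval]
      cases hxi : x i <;> simpa [hxi] using this

/-- Every level of a truncated path reveals a new coordinate, and one more is requested at the cut,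
hence the strict inequality. Counting only coordinates unset in `ρ` lets the count drop at each
level of the induction. -/
lemma lt_card_revealed_of_truncated (hF : LocallyDetermined F) (d : ℕ) :
    ∀ {ρ x}, Consistent ρ x → Truncated F x d ρ →
      d < ((revealed n (F x)).filter fun i => ρ i = none).card := by
  induction d with
  | zero =>
    intro ρ x hx ht
    rcases hF ρ x hx with ⟨h, -⟩ | ⟨i, h, hi, hi'⟩
    · simp [Truncated, h] at ht
    · exact Finset.card_pos.2 ⟨i, by simp [hi, hi']⟩
  | succ d ih =>
    intro ρ x hx ht
    rcases hF ρ x hx with ⟨h, -⟩ | ⟨i, h, hi, hi'⟩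
    · simp [Truncated, h] at ht
    · simp only [Truncated, h] at ht
      refine Nat.lt_of_le_of_lt (ih (hx.update (i := i) rfl) ht) (Finset.card_lt_card ?_)
      rw [Finset.ssubset_iff_of_subset]
      · exact ⟨i, by simp [hi, hi'], by simp⟩
      · intro j hj
        simp only [Finset.mem_filter] at hj ⊢
        refine ⟨hj.1, ?_⟩
        by_cases hji : j = i
        · subst hji; exact hi
        · simpa [hji] using hj.2

open Classical in
-- Fixing one more coordinate halves a subcube, as flipping that coordinate exchanges the halves.
lemma card_consistent_update {ρ : Fin n → Option Bool} {i : Fin n} (hi : ρ i = none) (b : Bool) :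
    2 * (Finset.univ.filter fun x => Consistent (Function.update ρ i (some b)) x).card
      = (Finset.univ.filter fun x => Consistent ρ x).card := by
  have hsplit : ∀ (x : Fin n → Bool) (c : Bool), Consistent (Function.update ρ i (some c)) x ↔
      Consistent ρ x ∧ x i = c := by
    intro x c
    refine ⟨fun h => ⟨fun j e hj => h j e ?_, h i c (by simp)⟩, fun h => h.1.update h.2⟩
    have hji : j ≠ i := by rintro rfl; simp [hi] at hj
    simpa [hji] using hj
  have hflip : ∀ x : Fin n → Bool, Consistent ρ (flipBit i x) ↔ Consistent ρ x := by
    intro x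
    refine forall_congr' fun j => forall_congr' fun e => imp_congr_right fun hj => ?_
    have hji : j ≠ i := by rintro rfl; simp [hi] at hj
    rw [flipBit_ne hji]
  have hcard : (Finset.univ.filter fun x => Consistent ρ x ∧ x i = !b).card
      = (Finset.univ.filter fun x => Consistent ρ x ∧ x i = b).card := by
    refine Finset.card_bij (fun x _ => flipBit i x) ?_ ?_ ?_
    · intro x hx
      simp only [Finset.mem_filter, Finset.mem_univ, true_and] at hx ⊢
      simp [hflip, hx.1, flipBit_same, hx.2]
    · intro x _ y _ h
      exact (flipBit_involutive i).injective h
    · intro y hy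
      simp only [Finset.mem_filter, Finset.mem_univ, true_and] at hy
      exact ⟨flipBit i y, by simp [hflip, hy.1, flipBit_same, hy.2], flipBit_involutive i y⟩
  simp only [hsplit]
  rw [two_mul]
  nth_rw 1 [← hcard]
  rw [← Finset.card_union_of_disjoint]
  · congr 1
    ext x
    cases b <;> cases h : x i <;> simp [h]
  · rw [Finset.disjoint_filter]
    rintro x - ⟨-, h⟩ ⟨-, h'⟩
    rw [h] at h'
    cases b <;> simp at h'

open Classical in
-- A truncated leaf lies at depth exactly `d`, so it receives a `2⁻ᵈ` fraction of the subcube. Thus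
-- the truncated fraction is a leaf count, which the learner computes without sampling.
lemma card_truncated (hF : LocallyDetermined F) (d : ℕ) : ∀ ρ,
    (Finset.univ.filter fun x => Consistent ρ x ∧ Truncated F x d ρ).card * 2 ^ d
      = truncCount F d ρ * (Finset.univ.filter fun x => Consistent ρ x).card := by
  induction d with
  | zero =>
    intro ρ
    cases h : (nextQuery F ρ).isSome <;> simp [Truncated, truncCount, h]
  | succ d ih =>
    intro ρ
    rcases hF ρ (fill ρ) (consistent_fill ρ) with ⟨h, -⟩ | ⟨i, h, hi, -⟩
    · simp [Truncated, truncCount, h]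
    · simp only [Truncated, truncCount, h]
      -- The inputs entering the child for `b` are those with `x i = b`, so the truncated inputs
      -- split according to the bit at `i`.
      have hs : ∀ b : Bool, (Finset.univ.filter fun x : Fin n → Bool =>
            Consistent (Function.update ρ i (some b)) x ∧
              Truncated F x d (Function.update ρ i (some b)))
          = Finset.univ.filter fun x : Fin n → Bool => (Consistent ρ x ∧
              Truncated F x d (Function.update ρ i (some (x i)))) ∧ x i = b := by
        intro b
        ext x
        simp only [Finset.mem_filter, Finset.mem_univ, true_and]
        constructor
        · rintro ⟨h₁, h₂⟩
          have hb : x i = b := h₁ i b (by simp)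
          refine ⟨⟨fun j e hj => h₁ j e ?_, hb ▸ h₂⟩, hb⟩
          have hji : j ≠ i := by rintro rfl; simp [hi] at hj
          simpa [hji] using hj
        · rintro ⟨⟨h₁, h₂⟩, rfl⟩
          exact ⟨h₁.update rfl, h₂⟩
      have h₀ := ih (Function.update ρ i (some false))
      have h₁ := ih (Function.update ρ i (some true))
      have c₀ := card_consistent_update hi false
      have c₁ := card_consistent_update hi true
      rw [hs] at h₀ h₁
      have hsum := Finset.card_filter_add_card_filter_not (s := Finset.univ.filter
        fun x : Fin n → Bool => Consistent ρ x ∧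
          Truncated F x d (Function.update ρ i (some (x i)))) (fun x => x i = true)
      simp only [Finset.filter_filter, Bool.not_eq_true] at hsum
      rw [← hsum, pow_succ, add_mul, add_mul]
      nth_rw 1 [← c₁]
      nth_rw 1 [← c₀]
      nlinarith

open Classical in
/-- The tree of a strategy computes its output except on truncated inputs. -/
lemma card_truncated_root (hF : LocallyDetermined F) (d : ℕ) :
    (Finset.univ.filter fun x => Truncated F x d fun _ => none).card * 2 ^ d
      = truncCount F d (fun _ => none) * 2 ^ n := by
  have := card_truncated hF d fun _ => none
  have hc : ∀ x : Fin n → Bool, Consistent (fun _ => none) x := fun x i b h => by simp at h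
  simpa [hc] using this

end StrategyTree

/-! ### Registers of the learner -/

/-- The registers of the learner, apart from those of the simulated strategy. -/
structure Regs : Type where
  io : Data := .nil
  nl : Data := .nil
  mm : Data := .nil
  root : Data := .nil
  sin : Data := .nil
  dep : Data := .nil
  wid : Data := .nil
  flag : Data := .nil
  tasks : Data := .nil
  res : Data := .nil
  cnt : Data := .nil
  used : Data := .nil
  rem : Data := .nil
  fst : Data := .nil
  arr : Data := .nil
  tdep : Data := .nil
  t1 : Data := .nil
  t2 : Data := .nil
  t3 : Data := .nil
  t4 : Data := .nil

def rIo : ℕ := 0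
def rNl : ℕ := 1
def rMm : ℕ := 2
def rRoot : ℕ := 3
def rSin : ℕ := 4
def rDep : ℕ := 5
def rWid : ℕ := 6
def rFlag : ℕ := 7
def rTasks : ℕ := 8
def rRes : ℕ := 9
def rCnt : ℕ := 10
def rUsed : ℕ := 11
def rRem : ℕ := 12
def rFst : ℕ := 13
def rArr : ℕ := 14
def rTdep : ℕ := 15
def rT1 : ℕ := 16
def rT2 : ℕ := 17
def rT3 : ℕ := 18
def rT4 : ℕ := 19

/-- The register of the learner that simulates register `v` of the strategy. -/
def simReg (v : ℕ) : ℕ := v + 20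

/-- The memory of the learner. -/
def toMem (r : Regs) (m : ℕ → Data) : ℕ → Data
  | 0 => r.io
  | 1 => r.nl
  | 2 => r.mm
  | 3 => r.root
  | 4 => r.sin
  | 5 => r.dep
  | 6 => r.wid
  | 7 => r.flag
  | 8 => r.tasks
  | 9 => r.res
  | 10 => r.cnt
  | 11 => r.used
  | 12 => r.rem
  | 13 => r.fst
  | 14 => r.arr
  | 15 => r.tdep
  | 16 => r.t1
  | 17 => r.t2
  | 18 => r.t3
  | 19 => r.t4
  | v + 20 => m v

section

variable (r : Regs) (m : ℕ → Data) (d : Data)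

@[simp] lemma toMem_simReg (v : ℕ) : toMem r m (simReg v) = m v := rfl
@[simp] lemma toMem_io : toMem r m rIo = r.io := rfl
@[simp] lemma toMem_nl : toMem r m rNl = r.nl := rfl
@[simp] lemma toMem_mm : toMem r m rMm = r.mm := rfl
@[simp] lemma toMem_root : toMem r m rRoot = r.root := rfl
@[simp] lemma toMem_sin : toMem r m rSin = r.sin := rfl
@[simp] lemma toMem_dep : toMem r m rDep = r.dep := rfl
@[simp] lemma toMem_wid : toMem r m rWid = r.wid := rfl
@[simp] lemma toMem_flag : toMem r m rFlag = r.flag := rfl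
@[simp] lemma toMem_tasks : toMem r m rTasks = r.tasks := rfl
@[simp] lemma toMem_res : toMem r m rRes = r.res := rfl
@[simp] lemma toMem_cnt : toMem r m rCnt = r.cnt := rfl
@[simp] lemma toMem_used : toMem r m rUsed = r.used := rfl
@[simp] lemma toMem_rem : toMem r m rRem = r.rem := rfl
@[simp] lemma toMem_fst : toMem r m rFst = r.fst := rfl
@[simp] lemma toMem_arr : toMem r m rArr = r.arr := rfl
@[simp] lemma toMem_tdep : toMem r m rTdep = r.tdep := rfl
@[simp] lemma toMem_t1 : toMem r m rT1 = r.t1 := rfl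
@[simp] lemma toMem_t2 : toMem r m rT2 = r.t2 := rfl
@[simp] lemma toMem_t3 : toMem r m rT3 = r.t3 := rfl
@[simp] lemma toMem_t4 : toMem r m rT4 = r.t4 := rfl

@[simp] lemma update_toMem_simReg (v : ℕ) :
    Function.update (toMem r m) (simReg v) d = toMem r (Function.update m v d) := by
  funext w
  by_cases hw : w = simReg v
  · subst hw; simp [toMem_simReg]
  · rw [Function.update_of_ne hw]
    match w with
    | 0 | 1 | 2 | 3 | 4 | 5 | 6 | 7 | 8 | 9 | 10 | 11 | 12 | 13 | 14 | 15 | 16 | 17 | 18 | 19 => rfl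
    | w + 20 =>
      have : w ≠ v := fun h => hw (by simp [h, simReg])
      simp [toMem, this]

@[simp] lemma update_toMem_io :
    Function.update (toMem r m) rIo d = toMem { r with io := d } m := by
  funext w
  rcases w with _ | _ | _ | _ | _ | _ | _ | _ | _ | _ | _ | _ | _ | _ | _ | _ | _ | _ | _ | _ | _ <;> rfl

@[simp] lemma update_toMem_mm :
    Function.update (toMem r m) rMm d = toMem { r with mm := d } m := by
  funext w
  rcases w with _ | _ | _ | _ | _ | _ | _ | _ | _ | _ | _ | _ | _ | _ | _ | _ | _ | _ | _ | _ | _ <;> rfl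

@[simp] lemma update_toMem_root :
    Function.update (toMem r m) rRoot d = toMem { r with root := d } m := by
  funext w
  rcases w with _ | _ | _ | _ | _ | _ | _ | _ | _ | _ | _ | _ | _ | _ | _ | _ | _ | _ | _ | _ | _ <;> rfl

@[simp] lemma update_toMem_sin :
    Function.update (toMem r m) rSin d = toMem { r with sin := d } m := by
  funext w
  rcases w with _ | _ | _ | _ | _ | _ | _ | _ | _ | _ | _ | _ | _ | _ | _ | _ | _ | _ | _ | _ | _ <;> rfl

@[simp] lemma update_toMem_dep :
    Function.update (toMem r m) rDep d = toMem { r with dep := d } m := by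
  funext w
  rcases w with _ | _ | _ | _ | _ | _ | _ | _ | _ | _ | _ | _ | _ | _ | _ | _ | _ | _ | _ | _ | _ <;> rfl

@[simp] lemma update_toMem_wid :
    Function.update (toMem r m) rWid d = toMem { r with wid := d } m := by
  funext w
  rcases w with _ | _ | _ | _ | _ | _ | _ | _ | _ | _ | _ | _ | _ | _ | _ | _ | _ | _ | _ | _ | _ <;> rfl

@[simp] lemma update_toMem_flag :
    Function.update (toMem r m) rFlag d = toMem { r with flag := d } m := by
  funext w
  rcases w with _ | _ | _ | _ | _ | _ | _ | _ | _ | _ | _ | _ | _ | _ | _ | _ | _ | _ | _ | _ | _ <;> rfl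

@[simp] lemma update_toMem_tasks :
    Function.update (toMem r m) rTasks d = toMem { r with tasks := d } m := by
  funext w
  rcases w with _ | _ | _ | _ | _ | _ | _ | _ | _ | _ | _ | _ | _ | _ | _ | _ | _ | _ | _ | _ | _ <;> rfl

@[simp] lemma update_toMem_res :
    Function.update (toMem r m) rRes d = toMem { r with res := d } m := by
  funext w
  rcases w with _ | _ | _ | _ | _ | _ | _ | _ | _ | _ | _ | _ | _ | _ | _ | _ | _ | _ | _ | _ | _ <;> rfl

@[simp] lemma update_toMem_cnt :
    Function.update (toMem r m) rCnt d = toMem { r with cnt := d } m := by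
  funext w
  rcases w with _ | _ | _ | _ | _ | _ | _ | _ | _ | _ | _ | _ | _ | _ | _ | _ | _ | _ | _ | _ | _ <;> rfl

@[simp] lemma update_toMem_used :
    Function.update (toMem r m) rUsed d = toMem { r with used := d } m := by
  funext w
  rcases w with _ | _ | _ | _ | _ | _ | _ | _ | _ | _ | _ | _ | _ | _ | _ | _ | _ | _ | _ | _ | _ <;> rfl

@[simp] lemma update_toMem_rem :
    Function.update (toMem r m) rRem d = toMem { r with rem := d } m := by
  funext w
  rcases w with _ | _ | _ | _ | _ | _ | _ | _ | _ | _ | _ | _ | _ | _ | _ | _ | _ | _ | _ | _ | _ <;> rfl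

@[simp] lemma update_toMem_fst :
    Function.update (toMem r m) rFst d = toMem { r with fst := d } m := by
  funext w
  rcases w with _ | _ | _ | _ | _ | _ | _ | _ | _ | _ | _ | _ | _ | _ | _ | _ | _ | _ | _ | _ | _ <;> rfl

@[simp] lemma update_toMem_arr :
    Function.update (toMem r m) rArr d = toMem { r with arr := d } m := by
  funext w
  rcases w with _ | _ | _ | _ | _ | _ | _ | _ | _ | _ | _ | _ | _ | _ | _ | _ | _ | _ | _ | _ | _ <;> rfl

@[simp] lemma update_toMem_tdep :
    Function.update (toMem r m) rTdep d = toMem { r with tdep := d } m := by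
  funext w
  rcases w with _ | _ | _ | _ | _ | _ | _ | _ | _ | _ | _ | _ | _ | _ | _ | _ | _ | _ | _ | _ | _ <;> rfl

@[simp] lemma update_toMem_t1 :
    Function.update (toMem r m) rT1 d = toMem { r with t1 := d } m := by
  funext w
  rcases w with _ | _ | _ | _ | _ | _ | _ | _ | _ | _ | _ | _ | _ | _ | _ | _ | _ | _ | _ | _ | _ <;> rfl

@[simp] lemma update_toMem_t2 :
    Function.update (toMem r m) rT2 d = toMem { r with t2 := d } m := by
  funext w
  rcases w with _ | _ | _ | _ | _ | _ | _ | _ | _ | _ | _ | _ | _ | _ | _ | _ | _ | _ | _ | _ | _ <;> rfl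

@[simp] lemma update_toMem_t3 :
    Function.update (toMem r m) rT3 d = toMem { r with t3 := d } m := by
  funext w
  rcases w with _ | _ | _ | _ | _ | _ | _ | _ | _ | _ | _ | _ | _ | _ | _ | _ | _ | _ | _ | _ | _ <;> rfl

@[simp] lemma update_toMem_t4 :
    Function.update (toMem r m) rT4 d = toMem { r with t4 := d } m := by
  funext w
  rcases w with _ | _ | _ | _ | _ | _ | _ | _ | _ | _ | _ | _ | _ | _ | _ | _ | _ | _ | _ | _ | _ <;> rfl

end

/-! ### Weakest preconditions with a step count -/

infixr:50 " ;; " => Prog.seq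

section WP

variable {Q : Type} {ans : Q → Data → Data} {ω : ℕ → Bool}

/-- The program halts from `s`, with a number of steps and a final state that satisfy `φ`. -/
def WP (ans : Q → Data → Data) (ω : ℕ → Bool) (P : Prog Q) (s : State Q)
    (φ : ℕ → State Q → Prop) : Prop :=
  ∃ t s', Exec ans ω P s t s' ∧ φ t s'

variable {φ ψ : ℕ → State Q → Prop} {s : State Q}

lemma WP.mono {P : Prog Q} (h : WP ans ω P s φ) (hφ : ∀ t s', φ t s' → ψ t s') :
    WP ans ω P s ψ := by
  obtain ⟨t, s', h₁, h₂⟩ := h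
  exact ⟨t, s', h₁, hφ _ _ h₂⟩

lemma wp_iff_of_exec {P : Prog Q} {t : ℕ} {s' : State Q} (h : Exec ans ω P s t s') :
    WP ans ω P s φ ↔ φ t s' := by
  refine ⟨?_, fun h' => ⟨t, s', h, h'⟩⟩
  rintro ⟨t₂, s₂, h₁, h₂⟩
  obtain ⟨rfl, rfl⟩ := h.unique h₁
  exact h₂

@[simp] lemma wp_skip : WP ans ω .skip s φ ↔ φ 1 s := wp_iff_of_exec (.skip s)

@[simp] lemma wp_setNil {v : ℕ} : WP ans ω (.setNil v) s φ ↔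
    φ 1 ⟨Function.update s.mem v .nil, s.coins, s.log⟩ := wp_iff_of_exec (.setNil v s)

@[simp] lemma wp_copy {v a : ℕ} : WP ans ω (.copy v a) s φ ↔
    φ 1 ⟨Function.update s.mem v (s.mem a), s.coins, s.log⟩ := wp_iff_of_exec (.copy v a s)

@[simp] lemma wp_cons {v a b : ℕ} : WP ans ω (.cons v a b) s φ ↔
    φ 1 ⟨Function.update s.mem v (.cons (s.mem a) (s.mem b)), s.coins, s.log⟩ :=
  wp_iff_of_exec (.cons v a b s)

@[simp] lemma wp_head {v a : ℕ} : WP ans ω (.head v a) s φ ↔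
    φ 1 ⟨Function.update s.mem v (s.mem a).head, s.coins, s.log⟩ := wp_iff_of_exec (.head v a s)

@[simp] lemma wp_tail {v a : ℕ} : WP ans ω (.tail v a) s φ ↔
    φ 1 ⟨Function.update s.mem v (s.mem a).tail, s.coins, s.log⟩ := wp_iff_of_exec (.tail v a s)

@[simp] lemma wp_coin {v : ℕ} : WP ans ω (.coin v) s φ ↔
    φ 1 ⟨Function.update s.mem v (.bit (ω s.coins)), s.coins + 1, s.log⟩ :=
  wp_iff_of_exec (.coin v s)

@[simp] lemma wp_query {q : Q} {v a : ℕ} : WP ans ω (.query q v a) s φ ↔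
    φ 1 ⟨Function.update s.mem v (ans q (s.mem a)), s.coins, (q, s.mem a) :: s.log⟩ :=
  wp_iff_of_exec (.query q v a s)

@[simp] lemma wp_seq {P P' : Prog Q} : WP ans ω (P ;; P') s φ ↔
    WP ans ω P s fun t s' => WP ans ω P' s' fun t' s'' => φ (t + t') s'' := by
  constructor
  · rintro ⟨t, s', h, hφ⟩
    cases h with
    | seq h₁ h₂ => exact ⟨_, _, h₁, _, _, h₂, hφ⟩
  · rintro ⟨t, s', h₁, t', s'', h₂, hφ⟩
    exact ⟨_, _, .seq h₁ h₂, hφ⟩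

lemma wp_ite {a : ℕ} {P P' : Prog Q} : WP ans ω (.ite a P P') s φ ↔
    if (s.mem a).truth then WP ans ω P s fun t s' => φ (t + 1) s'
    else WP ans ω P' s fun t s' => φ (t + 1) s' := by
  split_ifs with ha
  · constructor
    · rintro ⟨t, s', h, hφ⟩
      cases h with
      | ite_true _ h => exact ⟨_, _, h, hφ⟩
      | ite_false hb _ => simp [ha] at hb
    · rintro ⟨t, s', h, hφ⟩
      exact ⟨_, _, .ite_true ha h, hφ⟩
  · rw [Bool.not_eq_true] at ha
    constructor
    · rintro ⟨t, s', h, hφ⟩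
      cases h with
      | ite_true hb _ => simp [ha] at hb
      | ite_false _ h => exact ⟨_, _, h, hφ⟩
    · rintro ⟨t, s', h, hφ⟩
      exact ⟨_, _, .ite_false ha h, hφ⟩

lemma wp_while {a : ℕ} {P : Prog Q} : WP ans ω (.while a P) s φ ↔
    if (s.mem a).truth then
      WP ans ω P s fun t s' => WP ans ω (.while a P) s' fun t' s'' => φ (t + t' + 1) s''
    else φ 1 s := by
  split_ifs with ha
  · constructor
    · rintro ⟨t, s', h, hφ⟩
      cases h with
      | while_true _ h₁ h₂ => exact ⟨_, _, h₁, _, _, h₂, hφ⟩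
      | while_false hb => simp [ha] at hb
    · rintro ⟨t, s', h₁, t', s'', h₂, hφ⟩
      exact ⟨_, _, .while_true ha h₁ h₂, hφ⟩
  · rw [Bool.not_eq_true] at ha
    exact wp_iff_of_exec (.while_false ha)

end WP
/-! ### Simulation of a strategy on a partially specified input -/

@[simp] lemma Data.truth_nil : Data.nil.truth = false := rfl
@[simp] lemma Data.truth_cons (a b : Data) : (Data.cons a b).truth = true := rfl
@[simp] lemma Data.head_nil : Data.nil.head = .nil := rfl
@[simp] lemma Data.head_cons (a b : Data) : (Data.cons a b).head = a := rfl
@[simp] lemma Data.tail_nil : Data.nil.tail = .nil := rfl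
@[simp] lemma Data.tail_cons (a b : Data) : (Data.cons a b).tail = b := rfl
@[simp] lemma Data.num_zero : Data.num 0 = .nil := rfl
@[simp] lemma Data.num_succ (k : ℕ) : Data.num (k + 1) = .cons .nil (.num k) := rfl
@[simp] lemma Data.bit_false : Data.bit false = .nil := rfl
@[simp] lemma Data.bit_true : Data.bit true = .cons .nil .nil := rfl

def Data.ofList : List Data → Data
  | [] => .nil
  | a :: l => .cons a (.ofList l)

@[simp] lemma Data.ofList_cons (a : Data) (l : List Data) :
    Data.ofList (a :: l) = .cons a (.ofList l) := rfl

/-- An entry of a partial assignment. -/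
def encodeEntry : Option Bool → Data
  | none => .cons (.cons .nil .nil) .nil
  | some b => .cons .nil (.bit b)

def encodePartial {n : ℕ} (ρ : Fin n → Option Bool) : Data :=
  .ofList ((List.ofFn ρ).map encodeEntry)

/-- The shift by one makes coordinate `0` pass the truth test, unlike `none`, and agrees with the
node labels of `DTree.encode`. -/
def encodeCoord {n : ℕ} : Option (Fin n) → Data
  | none => .nil
  | some i => .num (i + 1)

/-- The coins `ω (j - 1), …, ω 0` as a list. -/
def usedCoins (ω : ℕ → Bool) : ℕ → Data
  | 0 => .nil
  | j + 1 => .cons (.bit (ω j)) (usedCoins ω j)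

/-- The coins `ω j, …, ω (j + k - 1)` as a list. -/
def spareCoins (ω : ℕ → Bool) : ℕ → ℕ → Data
  | _, 0 => .nil
  | j, k + 1 => .cons (.bit (ω j)) (spareCoins ω (j + 1) k)

/-- Coins that were tossed in an earlier run are reused, and an input query is answered from the
partial assignment in register `rArr`. -/
def simulate : Prog StrategyOracle → Prog Unit
  | .skip => .skip
  | .setNil v => .setNil (simReg v)
  | .copy v a => .copy (simReg v) (simReg a)
  | .cons v a b => .cons (simReg v) (simReg a) (simReg b)
  | .head v a => .head (simReg v) (simReg a)
  | .tail v a => .tail (simReg v) (simReg a)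
  | .coin v =>
      -- Recorded coins come first; a fresh one is tossed only when none is left. Either way the
      -- coin joins the used ones.
      .ite rRem (.head (simReg v) rRem ;; .tail rRem rRem) (.coin (simReg v)) ;;
      .cons rUsed (simReg v) rUsed
  | .query .blackbox v a => .query () (simReg v) (simReg a)
  | .query .input v a =>
      .copy rT1 (simReg a) ;; .copy rT2 rArr ;;
      -- The argument is an index in unary: `rT2` walks down the assignment while `rT3` copies the
      -- index.
      .while rT1 (.tail rT1 rT1 ;; .tail rT2 rT2 ;; .cons rT3 rNl rT3) ;;
      .head rT2 rT2 ;; .tail (simReg v) rT2 ;; .head rT2 rT2 ;;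
      -- The head of an entry marks it as unset, and its tail, already stored, is the answer (`nil`,
      -- that is zero, when unset). Only the first unset request is kept.
      .ite rT2 (.ite rFst .skip (.cons rFst rNl rT3)) .skip ;;
      .setNil rT2 ;; .setNil rT3
  | .seq P P' => .seq (simulate P) (simulate P')
  | .ite a P P' => .ite (simReg a) (simulate P) (simulate P')
  | .while a P => .while (simReg a) (simulate P)

def Data.drop : ℕ → Data → Data
  | 0, d => d
  | k + 1, d => d.tail.drop k

lemma Data.head_drop (k : ℕ) : ∀ d : Data, (d.drop k).head = d.get k := by
  induction k with
  | zero => intro d; rfl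
  | succ k ih => intro d; exact ih d.tail

lemma Data.get_ofList (l : List Data) : ∀ k, (Data.ofList l).get k = l[k]?.getD .nil := by
  induction l with
  | nil =>
    intro k
    induction k with
    | zero => rfl
    | succ k ih => exact ih
  | cons a l ih =>
    intro k
    cases k with
    | zero => rfl
    | succ k => simpa [get] using ih k

lemma get_encodePartial {n : ℕ} (ρ : Fin n → Option Bool) (k : ℕ) :
    (encodePartial ρ).get k = if h : k < n then encodeEntry (ρ ⟨k, h⟩) else .nil := by
  rw [encodePartial, Data.get_ofList]
  split_ifs with h <;> simp [h]

section Simulation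

variable {n : ℕ} {f : BoolFn n} {ω : ℕ → Bool}

lemma wp_lookup_loop (r : Regs) (m : ℕ → Data) (c : ℕ) (lg : List (Unit × Data))
    {ans : Unit → Data → Data} (e : Data) :
    ∀ (a : Data) (k : ℕ) {φ : ℕ → State Unit → Prop},
    φ (4 * e.length + 1)
      ⟨toMem { r with nl := .nil, t1 := .nil, t2 := a.drop e.length,
                        t3 := .num (k + e.length) } m, c, lg⟩ →
    WP ans ω (.while rT1 (.tail rT1 rT1 ;; .tail rT2 rT2 ;; .cons rT3 rNl rT3))
      ⟨toMem { r with nl := .nil, t1 := e, t2 := a, t3 := .num k } m, c, lg⟩ φ := by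
  induction e with
  | nil =>
    intro a k φ h
    rw [wp_while]
    simpa [Data.length, Data.drop] using h
  | cons _ e _ ih =>
    intro a k φ h
    rw [wp_while]
    simp only [wp_seq, wp_tail, wp_cons, toMem_t1, Data.truth_cons, if_true, update_toMem_t1,
      Data.tail_cons, toMem_t2, update_toMem_t2, toMem_t3, toMem_nl, update_toMem_t3]
    refine ih a.tail (k + 1) ?_
    convert h using 1
    · simp only [Data.length]; ring
    · simp only [Data.length, Data.drop]
      rw [show k + 1 + e.length = k + (e.length + 1) by ring]

/-- The learner's registers while it simulates the strategy in state `s`; it has `k` spare coins. -/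
def simRegs (r : Regs) (ρ : Fin n → Option Bool) (ω : ℕ → Bool) (s : State StrategyOracle)
    (k : ℕ) : Regs :=
  { r with
    nl := .nil
    used := usedCoins ω s.coins
    rem := spareCoins ω s.coins k
    fst := encodeCoord (firstUnset ρ s.log)
    arr := encodePartial ρ
    t1 := .nil
    t2 := .nil
    t3 := .nil }

lemma height_strategyAnswer_le {x : Fin n → Bool} (q : StrategyOracle) (d : Data) :
    (strategyAnswer f x q d).height ≤ 1 := by
  cases q
  · exact Data.height_bit_le _
  · simp only [strategyAnswer]
    split_ifs
    · exact Data.height_bit_le _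
    · simp [Data.height]

/-- The invariant is that the learner has tossed `s.coins + k` coins, the last `k` being spare and
still ahead of the simulated run; so both sources of coins deliver `ω s.coins`. The factor `4 * B +
20` per simulated step pays for the lookup, whose argument has length at most `B`. -/
lemma wp_simulate (r : Regs) {ρ : Fin n → Option Bool} {P : Prog StrategyOracle}
    {s s' : State StrategyOracle} {t : ℕ} (h : Exec (strategyAnswer f (fill ρ)) ω P s t s') :
    ∀ {A B : ℕ}, (∀ v, (s.mem v).height ≤ A) → A + t ≤ B → ∀ k lg,
    WP (learnerAnswer f) ω (simulate P) ⟨toMem (simRegs r ρ ω s k) s.mem, s.coins + k, lg⟩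
      fun u z => u ≤ t * (4 * B + 20) ∧ ∃ k' lg',
        z = ⟨toMem (simRegs r ρ ω s' k') s'.mem, s'.coins + k', lg'⟩ := by
  induction h with
  | skip s =>
    intro A B _ _ k lg
    simp only [simulate, wp_skip]
    exact ⟨by omega, k, lg, rfl⟩
  | setNil v s =>
    intro A B _ _ k lg
    simp only [simulate, wp_setNil, update_toMem_simReg]
    exact ⟨by omega, k, lg, rfl⟩
  | copy v a s =>
    intro A B _ _ k lg
    simp only [simulate, wp_copy, update_toMem_simReg, toMem_simReg]
    exact ⟨by omega, k, lg, rfl⟩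
  | cons v a b s =>
    intro A B _ _ k lg
    simp only [simulate, wp_cons, update_toMem_simReg, toMem_simReg]
    exact ⟨by omega, k, lg, rfl⟩
  | head v a s =>
    intro A B _ _ k lg
    simp only [simulate, wp_head, update_toMem_simReg, toMem_simReg]
    exact ⟨by omega, k, lg, rfl⟩
  | tail v a s =>
    intro A B _ _ k lg
    simp only [simulate, wp_tail, update_toMem_simReg, toMem_simReg]
    exact ⟨by omega, k, lg, rfl⟩
  | coin v s =>
    intro A B _ _ k lg
    simp only [simulate, wp_seq, wp_ite, toMem_rem]
    cases k with
    | zero =>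
      simp only [simRegs, spareCoins, Data.truth_nil, Bool.false_eq_true, if_false, wp_coin,
        update_toMem_simReg, wp_cons, toMem_simReg, Function.update_self, toMem_used,
        update_toMem_used]
      exact ⟨by omega, 0, lg, rfl⟩
    | succ k =>
      simp only [simRegs, spareCoins, Data.truth_cons, if_true, wp_head, wp_seq, wp_tail,
        update_toMem_simReg, wp_cons, toMem_simReg, Function.update_self, toMem_used,
        update_toMem_used, toMem_rem, update_toMem_rem, Data.head_cons, Data.tail_cons]
      refine ⟨by omega, k, lg, ?_⟩
      simp only [State.write, usedCoins]
      -- Using a spare coin advances the simulated counter but not that of the learner.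
      rw [show s.coins + (k + 1) = s.coins + 1 + k by ring]
  | query q v a s =>
    intro A B hA hB k lg
    cases q with
    | blackbox =>
      simp only [simulate, wp_query, update_toMem_simReg, toMem_simReg]
      refine ⟨by omega, k, ((), s.mem a) :: lg, ?_⟩
      simp only [State.write, strategyAnswer, learnerAnswer, simRegs, firstUnset, unsetQuery,
        Option.or_none]
    | input =>
      have hlen : (s.mem a).length ≤ A := (Data.length_le_height _).trans (hA a)
      simp only [simulate, wp_seq, wp_copy, toMem_simReg, update_toMem_t1, toMem_arr,
        update_toMem_t2, simRegs]
      refine wp_lookup_loop (simRegs r ρ ω s k) _ _ _ (s.mem a) _ 0 ?_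
      simp only [wp_head, wp_tail, wp_ite, wp_skip, wp_setNil, wp_cons, toMem_t2,
        update_toMem_t2, Data.head_drop, update_toMem_simReg, toMem_simReg, toMem_fst, toMem_t3,
        update_toMem_t3, toMem_nl, update_toMem_fst, get_encodePartial, zero_add, simRegs]
      have hfin : ∀ {u : ℕ} {z : Regs} {b : Data}, u ≤ 4 * A + 20 →
          b = strategyAnswer f (fill ρ) .input (s.mem a) →
          z = { simRegs r ρ ω s k with
            fst := encodeCoord ((firstUnset ρ s.log).or (unsetQuery ρ .input (s.mem a))) } →
          u ≤ 1 * (4 * B + 20) ∧ ∃ k' lg',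
            (⟨toMem z (Function.update s.mem v b), s.coins + k, lg⟩ : State Unit)
            = ⟨toMem (simRegs r ρ ω { s.write v (strategyAnswer f (fill ρ) .input (s.mem a)) with
                log := (.input, s.mem a) :: s.log } k')
              (s.write v (strategyAnswer f (fill ρ) .input (s.mem a))).mem,
              (s.write v (strategyAnswer f (fill ρ) .input (s.mem a))).coins + k', lg'⟩ := by
        rintro u _ _ hu rfl rfl
        exact ⟨by omega, k, lg, rfl⟩
      by_cases hd : (s.mem a).length < n
      · rcases hρ : ρ ⟨_, hd⟩ with _ | b
        · cases hf : firstUnset ρ s.log with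
          | none =>
            simp only [hd, hρ, encodeEntry, encodeCoord, dif_pos, Data.head_cons, Data.truth_cons,
              if_true, Data.truth_nil, Bool.false_eq_true, if_false, wp_cons, toMem_t3, toMem_nl,
              update_toMem_fst, toMem_t2, update_toMem_t2, update_toMem_t3]
            refine hfin (by omega) ?_ ?_
            · simp [strategyAnswer, hd, fill, hρ]
            · simp [simRegs, hf, unsetQuery, hd, hρ, encodeCoord]
          | some i =>
            simp only [hd, hρ, encodeEntry, encodeCoord, dif_pos, Data.head_cons, Data.truth_cons,
              if_true, Data.num_succ, wp_skip, update_toMem_t2, update_toMem_t3]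
            refine hfin (by omega) ?_ ?_
            · simp [strategyAnswer, hd, fill, hρ]
            · simp [simRegs, hf, encodeCoord]
        · simp only [hd, hρ, encodeEntry, dif_pos, Data.head_cons, Data.truth_nil,
            if_false, Bool.false_eq_true, wp_skip, update_toMem_t2, update_toMem_t3]
          refine hfin (by omega) ?_ ?_
          · simp [strategyAnswer, hd, fill, hρ]
          · simp [simRegs, unsetQuery, hd, hρ]
      · simp only [hd, dif_neg, not_false_eq_true, Data.head_nil, Data.truth_nil,
            if_false, Bool.false_eq_true, wp_skip, update_toMem_t2, update_toMem_t3]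
        refine hfin (by omega) ?_ ?_
        · simp [strategyAnswer, hd]
        · simp [simRegs, unsetQuery, hd]
  | seq h₁ _ ih ih' =>
    intro A B hA hB k lg
    simp only [simulate, wp_seq]
    refine (ih (B := B) hA (by omega) k lg).mono ?_
    rintro u _ ⟨hu, k', lg', rfl⟩
    refine (ih' (B := B) (h₁.height_le height_strategyAnswer_le hA) (by omega) k' lg').mono ?_
    rintro u' _ ⟨hu', k'', lg'', rfl⟩
    exact ⟨by rw [add_mul]; omega, k'', lg'', rfl⟩
  | ite_true ha _ ih =>
    intro A B hA hB k lg
    simp only [simulate, wp_ite, toMem_simReg, ha, if_true]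
    refine (ih (B := B) hA (by omega) k lg).mono ?_
    rintro u _ ⟨hu, k', lg', rfl⟩
    exact ⟨by rw [add_mul]; omega, k', lg', rfl⟩
  | ite_false ha _ ih =>
    intro A B hA hB k lg
    simp only [simulate, wp_ite, toMem_simReg, ha, if_false, Bool.false_eq_true]
    refine (ih (B := B) hA (by omega) k lg).mono ?_
    rintro u _ ⟨hu, k', lg', rfl⟩
    exact ⟨by rw [add_mul]; omega, k', lg', rfl⟩
  | while_true ha h₁ _ ih ih' =>
    intro A B hA hB k lg
    rw [simulate, wp_while]
    simp only [toMem_simReg, ha, if_true]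
    refine (ih (B := B) hA (by omega) k lg).mono ?_
    rintro u _ ⟨hu, k', lg', rfl⟩
    refine (ih' (B := B) (h₁.height_le height_strategyAnswer_le hA) (by omega) k' lg').mono ?_
    rintro u' _ ⟨hu', k'', lg'', rfl⟩
    exact ⟨by rw [add_mul, add_mul]; omega, k'', lg'', rfl⟩
  | while_false ha =>
    intro A B hA hB k lg
    rw [simulate, wp_while]
    simp only [toMem_simReg, ha, if_false, Bool.false_eq_true]
    exact ⟨by omega, k, lg, rfl⟩

end Simulation

/-! ### The learner -/

/-- `cons c` times. -/
def consRepeat : ℕ → Prog Unit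
  | 0 => .skip
  | c + 1 => .cons rMm rNl rMm ;; consRepeat c

def clearRegs : ℕ → Prog Unit
  | 0 => .skip
  | v + 1 => .setNil (simReg v) ;; clearRegs v

/-- Put all coins back. -/
def rewindProg : Prog Unit :=
  .while rUsed (.head rT1 rUsed ;; .cons rRem rT1 rRem ;; .tail rUsed rUsed) ;; .setNil rT1

/-- Run the strategy on the partial assignment in `rArr`. -/
def runProg (S : Prog StrategyOracle) : Prog Unit :=
  -- The `+ 1` covers register `0`, which holds the input even if `S` writes to no register.
  rewindProg ;; .setNil rFst ;; clearRegs (S.regBound + 1) ;; .copy (simReg 0) rSin ;; simulate S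

/-- Push the leaf with the output of the strategy. -/
def leafProg : Prog Unit :=
  .ite (simReg 0) (.cons rT1 rNl rNl) .skip ;; .cons rT1 rNl rT1 ;; .cons rRes rT1 rRes ;;
  .setNil rT1

/-- Push a truncated leaf, and count it. -/
def truncProg : Prog Unit :=
  .copy rT1 rMm ;; .while rT1 (.tail rT1 rT1 ;; .cons rCnt rNl rCnt) ;;
  .cons rT1 rNl rNl ;; .cons rRes rT1 rRes ;; .setNil rT1

/-- Replace a task by the tasks for its two children and for the node that joins them. -/
def expandProg : Prog Unit :=
  -- The joining task is pushed first, so that it is carried out after both children.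
  .cons rT2 rFst rNl ;; .cons rTasks rT2 rTasks ;; .tail rTdep rTdep ;; .tail rT1 rFst ;;
  -- The prefix before coordinate `i` goes to `rT3` in reverse; entry `i` is then replaced by its
  -- two values, in `rT4` (false) and `rArr` (true), and the prefix is put back on both.
  .while rT1 (.head rT2 rArr ;; .cons rT3 rT2 rT3 ;; .tail rArr rArr ;; .tail rT1 rT1) ;;
  .tail rArr rArr ;; .cons rT2 rNl rNl ;; .cons rT4 rT2 rArr ;; .cons rT2 rNl rT2 ;;
  .cons rArr rT2 rArr ;;
  .while rT3 (.head rT2 rT3 ;; .cons rT4 rT2 rT4 ;; .cons rArr rT2 rArr ;; .tail rT3 rT3) ;;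
  -- The task for `false` ends on top, so the left subtree is finished first and lies below the
  -- right one among the results.
  .cons rT1 rArr rTdep ;; .cons rT1 rNl rT1 ;; .cons rTasks rT1 rTasks ;;
  .cons rT1 rT4 rTdep ;; .cons rT1 rNl rT1 ;; .cons rTasks rT1 rTasks ;;
  .setNil rT1 ;; .setNil rT2 ;; .setNil rT4

/-- Join the two topmost results by the node with label `rT2`. -/
def nodeProg : Prog Unit :=
  .head rT3 rRes ;; .tail rRes rRes ;; .head rT4 rRes ;; .tail rRes rRes ;;
  .cons rT3 rT4 rT3 ;; .cons rT3 rT2 rT3 ;; .cons rRes rT3 rRes ;;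
  .setNil rT1 ;; .setNil rT2 ;; .setNil rT3 ;; .setNil rT4

def buildProg (S : Prog StrategyOracle) : Prog Unit :=
  .tail rT1 rT1 ;; .head rArr rT1 ;; .tail rTdep rT1 ;; .setNil rT1 ;; runProg S ;;
  .ite rFst (.ite rTdep expandProg truncProg) leafProg ;; .setNil rArr ;; .setNil rTdep ;;
  .setNil rFst

/-- Carry out the topmost task. -/
def taskProg (S : Prog StrategyOracle) : Prog Unit :=
  .head rT1 rTasks ;; .tail rTasks rTasks ;; .head rT2 rT1 ;; .ite rT2 nodeProg (buildProg S)

/-- Build the truncated tree; stop if few of its leaves are truncated, else increase the depth. -/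
def roundProg (S : Prog StrategyOracle) : Prog Unit :=
  .cons rT1 rRoot rDep ;; .cons rT1 rNl rT1 ;; .cons rTasks rT1 rNl ;; .setNil rT1 ;;
  .setNil rRes ;; .setNil rCnt ;; .while rTasks (taskProg S) ;;
  -- Truncated subtraction: `rT2` stays nonzero exactly when `M` times the number of truncated
  -- leaves is below `2 ^ d`.
  .copy rT1 rCnt ;; .copy rT2 rWid ;; .while rT1 (.tail rT1 rT1 ;; .tail rT2 rT2) ;;
  .ite rT2 (.setNil rFlag)
    (.cons rDep rNl rDep ;;
      .while rWid (.tail rWid rWid ;; .cons rT3 rNl rT3 ;; .cons rT3 rNl rT3) ;;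
      .copy rWid rT3 ;; .setNil rT3) ;;
  .setNil rT2

/-- Compute the error parameter `1 / M` of the strategy, where `M` is `c` times the product of
the denominators of `ε` and `δ`. -/
def setupProg (c : ℕ) : Prog Unit :=
  -- Only the denominators matter, since a positive rational is at least the inverse of its
  -- denominator.
  .head rT1 rIo ;; .copy rT2 rT1 ;; .tail rIo rIo ;; .head rT3 rIo ;; .tail rT3 rT3 ;;
  .tail rT4 rIo ;; .tail rT4 rT4 ;;
  .while rT3 (.tail rT3 rT3 ;; .copy rArr rT4 ;; .while rArr (.tail rArr rArr ;; consRepeat c)) ;;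
  .cons rFlag rNl rNl ;; .copy rWid rFlag ;; .cons rSin rFlag rMm ;; .cons rSin rT1 rSin ;;
  .cons rT3 rFlag rNl ;; .while rT2 (.tail rT2 rT2 ;; .cons rRoot rT3 rRoot) ;;
  .setNil rT1 ;; .setNil rT3 ;; .setNil rT4 ;; .setNil rIo

/-- The depth is found by search, so the program depends on `S` and `c` alone, not on `k` or on the
bounds that come with it. -/
def learner (S : Prog StrategyOracle) (c : ℕ) : Prog Unit :=
  setupProg c ;; .while rFlag (roundProg S) ;; .head rIo rRes

/-! ### Correctness of the loops -/

section Loops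

variable {ans : Unit → Data → Data} {ω : ℕ → Bool} (r : Regs) (m : ℕ → Data) (co : ℕ)
  (lg : List (Unit × Data))

lemma wp_clearRegs (b : ℕ) : ∀ (m : ℕ → Data) {φ : ℕ → State Unit → Prop},
    φ (b + 1) ⟨toMem r (fun v => if v < b then .nil else m v), co, lg⟩ →
    WP ans ω (clearRegs b) ⟨toMem r m, co, lg⟩ φ := by
  induction b with
  | zero => intro m φ h; simpa [clearRegs] using h
  | succ b ih =>
    intro m φ h
    simp only [clearRegs, wp_seq, wp_setNil, update_toMem_simReg]
    refine ih _ ?_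
    convert h using 1
    · ring
    · congr 2
      funext v
      rcases lt_trichotomy v b with hv | hv | hv
      · simp [hv, hv.trans (Nat.lt_succ_self b)]
      · simp [hv]
      · simp [hv.ne', Nat.not_lt.2 hv.le, show ¬ v < b + 1 by omega]

lemma wp_consRepeat (c : ℕ) : ∀ (k : ℕ) {φ : ℕ → State Unit → Prop},
    φ (c + 1) ⟨toMem { r with nl := .nil, mm := .num (k + c) } m, co, lg⟩ →
    WP ans ω (consRepeat c) ⟨toMem { r with nl := .nil, mm := .num k } m, co, lg⟩ φ := by
  induction c with
  | zero => intro k φ h; simpa [consRepeat] using h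
  | succ c ih =>
    intro k φ h
    simp only [consRepeat, wp_seq, wp_cons, toMem_nl, toMem_mm, update_toMem_mm]
    refine ih (k + 1) ?_
    convert h using 1
    · ring
    · rw [show k + 1 + c = k + (c + 1) by ring]

/-- Used coins are stored latest first, so moving them one by one onto the spare ones restores the
order of tossing from index `0`. -/
lemma wp_rewind (j : ℕ) : ∀ (k : ℕ) {φ : ℕ → State Unit → Prop},
    φ (4 * j + 2) ⟨toMem { r with used := .nil, rem := spareCoins ω 0 (j + k), t1 := .nil } m,
      co, lg⟩ → ∀ d : Data,
    WP ans ω rewindProg ⟨toMem { r with used := usedCoins ω j, rem := spareCoins ω j k, t1 := d } m,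
      co, lg⟩ φ := by
  induction j with
  | zero =>
    intro k φ h d
    simp only [rewindProg, wp_seq]
    rw [wp_while]
    simpa [usedCoins] using h
  | succ j ih =>
    intro k φ h d
    have key := fun ψ => ih (k + 1) (φ := ψ)
    simp only [rewindProg, wp_seq] at key ⊢
    rw [wp_while]
    simp only [usedCoins, toMem_used, Data.truth_cons, if_true, wp_seq, wp_head, wp_cons, wp_tail,
      update_toMem_t1, update_toMem_used, update_toMem_rem, toMem_t1, toMem_rem, Data.head_cons,
      Data.tail_cons]
    refine (key (fun t s => φ (t + 4) s) ?_ _).mono ?_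
    · convert h using 1
      · ring
      · rw [show j + (k + 1) = j + 1 + k by ring]
    · intro t s h
      refine h.mono fun t' s' h' => ?_
      convert h' using 1
      ring

lemma wp_count_loop (a : ℕ) : ∀ (k : ℕ) {φ : ℕ → State Unit → Prop},
    φ (3 * a + 1) ⟨toMem { r with nl := .nil, t1 := .nil, cnt := .num (k + a) } m, co, lg⟩ →
    WP ans ω (.while rT1 (.tail rT1 rT1 ;; .cons rCnt rNl rCnt))
      ⟨toMem { r with nl := .nil, t1 := .num a, cnt := .num k } m, co, lg⟩ φ := by
  induction a with
  | zero => intro k φ h; rw [wp_while]; simpa using h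
  | succ a ih =>
    intro k φ h
    rw [wp_while]
    simp only [Data.num_succ, toMem_t1, Data.truth_cons, if_true, wp_seq, wp_tail, wp_cons,
      update_toMem_t1, toMem_cnt, toMem_nl, update_toMem_cnt, Data.tail_cons]
    refine ih (k + 1) ?_
    convert h using 1
    · ring
    · rw [show k + 1 + a = k + (a + 1) by ring]

lemma wp_compare_loop (a : ℕ) : ∀ (b : ℕ) {φ : ℕ → State Unit → Prop},
    φ (3 * a + 1) ⟨toMem { r with t1 := .nil, t2 := .num (b - a) } m, co, lg⟩ →
    WP ans ω (.while rT1 (.tail rT1 rT1 ;; .tail rT2 rT2))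
      ⟨toMem { r with t1 := .num a, t2 := .num b } m, co, lg⟩ φ := by
  induction a with
  | zero => intro b φ h; rw [wp_while]; simpa using h
  | succ a ih =>
    intro b φ h
    rw [wp_while]
    simp only [Data.num_succ, toMem_t1, Data.truth_cons, if_true, wp_seq, wp_tail,
      update_toMem_t1, toMem_t2, update_toMem_t2, Data.tail_cons]
    have hb : (Data.num b).tail = .num (b - 1) := by cases b <;> rfl
    rw [hb]
    refine ih (b - 1) ?_
    convert h using 1
    · ring
    · rw [show b - 1 - a = b - (a + 1) by omega]

lemma wp_double_loop (a : ℕ) : ∀ (k : ℕ) {φ : ℕ → State Unit → Prop},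
    φ (4 * a + 1) ⟨toMem { r with nl := .nil, wid := .nil, t3 := .num (k + 2 * a) } m, co, lg⟩ →
    WP ans ω (.while rWid (.tail rWid rWid ;; .cons rT3 rNl rT3 ;; .cons rT3 rNl rT3))
      ⟨toMem { r with nl := .nil, wid := .num a, t3 := .num k } m, co, lg⟩ φ := by
  induction a with
  | zero => intro k φ h; rw [wp_while]; simpa using h
  | succ a ih =>
    intro k φ h
    rw [wp_while]
    simp only [Data.num_succ, toMem_wid, Data.truth_cons, if_true, wp_seq, wp_tail, wp_cons,
      update_toMem_wid, toMem_t3, toMem_nl, update_toMem_t3, Data.tail_cons]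
    refine ih (k + 2) ?_
    convert h using 1
    · ring
    · rw [show k + 2 + 2 * a = k + 2 * (a + 1) by ring]

lemma wp_unzip_loop (l : List Data) (a : Data) : ∀ (b d : Data) {φ : ℕ → State Unit → Prop},
    (∀ d', φ (5 * l.length + 1) ⟨toMem { r with
        t1 := .nil,
        arr := a,
        t2 := d',
        t3 := l.foldl (fun z e => .cons e z) b } m, co, lg⟩) →
    WP ans ω (.while rT1
        (.head rT2 rArr ;; .cons rT3 rT2 rT3 ;; .tail rArr rArr ;; .tail rT1 rT1))
      ⟨toMem { r with t1 := .num l.length, arr := l.foldr .cons a, t2 := d, t3 := b } m, co, lg⟩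
      φ := by
  induction l with
  | nil => intro b d φ h; rw [wp_while]; simpa using h d
  | cons e l ih =>
    intro b d φ h
    rw [wp_while]
    simp only [List.length_cons, Data.num_succ, toMem_t1, Data.truth_cons, if_true, wp_seq,
      wp_head, wp_tail, wp_cons, update_toMem_t1, toMem_t2, update_toMem_t2, toMem_t3,
      update_toMem_t3, toMem_arr, update_toMem_arr, Data.tail_cons, Data.head_cons, List.foldr_cons]
    refine ih (.cons e b) e fun d' => ?_
    convert h d' using 1
    · simp only [List.length_cons]
      ring
    · rfl

lemma wp_zip_loop (l : List Data) : ∀ (a a' d : Data) {φ : ℕ → State Unit → Prop},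
    (∀ d', φ (5 * l.length + 1) ⟨toMem { r with
        arr := l.foldr .cons a,
        t2 := d',
        t3 := .nil,
        t4 := l.foldr .cons a' } m, co, lg⟩) →
    WP ans ω (.while rT3
        (.head rT2 rT3 ;; .cons rT4 rT2 rT4 ;; .cons rArr rT2 rArr ;; .tail rT3 rT3))
      ⟨toMem { r with arr := a, t2 := d, t3 := l.foldl (fun z e => .cons e z) .nil, t4 := a' } m,
        co, lg⟩ φ := by
  -- The list in `rT3` is reversed, so the loop takes the last entry of `l` first.
  induction l using List.reverseRecOn with
  | nil => intro a a' d φ h; rw [wp_while]; simpa using h d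
  | append_singleton l e ih =>
    intro a a' d φ h
    rw [wp_while]
    simp only [List.foldl_append, List.foldl_cons, List.foldl_nil, toMem_t3, Data.truth_cons,
      if_true, wp_seq, wp_head, wp_tail, wp_cons, update_toMem_t2, toMem_t2,
      update_toMem_t3, toMem_t4, update_toMem_t4, toMem_arr, update_toMem_arr, Data.tail_cons,
      Data.head_cons]
    refine ih _ _ e fun d' => ?_
    convert h d' using 1
    · simp only [List.length_append, List.length_cons, List.length_nil]
      ring
    · simp only [List.foldr_append, List.foldr_cons, List.foldr_nil]

lemma wp_root_loop (e : Data) (l : List Data) : ∀ (a : ℕ) {φ : ℕ → State Unit → Prop},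
    φ (3 * a + 1) ⟨toMem { r with
        t2 := .nil,
        t3 := e,
        root := .ofList (List.replicate a e ++ l) } m, co, lg⟩ →
    WP ans ω (.while rT2 (.tail rT2 rT2 ;; .cons rRoot rT3 rRoot))
      ⟨toMem { r with t2 := .num a, t3 := e, root := .ofList l } m, co, lg⟩ φ := by
  intro a
  induction a generalizing l with
  | zero => intro φ h; rw [wp_while]; simpa using h
  | succ a ih =>
    intro φ h
    rw [wp_while]
    simp only [Data.num_succ, toMem_t2, Data.truth_cons, if_true, wp_seq, wp_tail, wp_cons,
      update_toMem_t2, toMem_t3, update_toMem_root, toMem_root, Data.tail_cons]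
    refine ih (e :: l) ?_
    convert h using 1
    · ring
    · rw [List.replicate_succ', List.append_assoc]
      rfl

lemma wp_scale_loop (c a : ℕ) : ∀ (k : ℕ) {φ : ℕ → State Unit → Prop},
    φ ((c + 3) * a + 1) ⟨toMem { r with nl := .nil, arr := .nil, mm := .num (k + a * c) } m, co,
      lg⟩ →
    WP ans ω (.while rArr (.tail rArr rArr ;; consRepeat c))
      ⟨toMem { r with nl := .nil, arr := .num a, mm := .num k } m, co, lg⟩ φ := by
  induction a with
  | zero => intro k φ h; rw [wp_while]; simpa using h
  | succ a ih =>
    intro k φ h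
    rw [wp_while]
    simp only [Data.num_succ, toMem_arr, Data.truth_cons, if_true, wp_seq, wp_tail,
      update_toMem_arr, Data.tail_cons]
    refine wp_consRepeat { r with arr := .num a } _ _ _ c k ?_
    refine ih (k + c) ?_
    convert h using 1
    · ring
    · rw [show k + c + a * c = k + (a + 1) * c by ring]

lemma wp_product_loop (c a b : ℕ) : ∀ (k : ℕ) {φ : ℕ → State Unit → Prop},
    φ (((c + 3) * b + 4) * a + 1) ⟨toMem { r with
        nl := .nil,
        arr := .nil,
        t3 := .nil,
        t4 := .num b,
        mm := .num (k + a * (b * c)) } m, co, lg⟩ →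
    WP ans ω (.while rT3
        (.tail rT3 rT3 ;; .copy rArr rT4 ;; .while rArr (.tail rArr rArr ;; consRepeat c)))
      ⟨toMem { r with nl := .nil, arr := .nil, t3 := .num a, t4 := .num b, mm := .num k } m, co, lg⟩
      φ := by
  induction a with
  | zero => intro k φ h; rw [wp_while]; simpa using h
  | succ a ih =>
    intro k φ h
    rw [wp_while]
    simp only [Data.num_succ, toMem_t3, Data.truth_cons, if_true, wp_seq, wp_tail, wp_copy,
      update_toMem_t3, toMem_t4, update_toMem_arr, Data.tail_cons]
    refine wp_scale_loop { r with t3 := .num a, t4 := .num b } _ _ _ c b k ?_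
    refine ih (k + b * c) ?_
    convert h using 1
    · ring
    · rw [show k + b * c + a * (b * c) = k + (a + 1) * (b * c) by ring]

end Loops

/-! ### Correctness of the tasks -/

lemma ofFn_update {α : Type*} {n : ℕ} (ρ : Fin n → α) (i : Fin n) (v : α) :
    List.ofFn (Function.update ρ i v) = (List.ofFn ρ).set i v := by
  refine List.ext_getElem (by simp) fun k h₁ h₂ => ?_
  simp only [List.getElem_ofFn, List.getElem_set, Function.update_apply, Fin.ext_iff]
  simp only [eq_comm]

lemma ofList_append_cons (l₁ l₂ : List Data) (e : Data) :
    Data.ofList (l₁ ++ e :: l₂) = l₁.foldr .cons (.cons e (.ofList l₂)) := by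
  induction l₁ with
  | nil => rfl
  | cons a l ih => simp [ih]

/-- The parts before and after entry `i` do not depend on the new value, so one decomposition serves
the parent and both children. -/
lemma exists_encodePartial_update {n : ℕ} (ρ : Fin n → Option Bool) (i : Fin n) :
    ∃ (l : List Data) (a : Data), l.length = i ∧ ∀ v,
      encodePartial (Function.update ρ i v) = l.foldr .cons (.cons (encodeEntry v) a) := by
  refine ⟨((List.ofFn ρ).map encodeEntry).take i,
    .ofList (((List.ofFn ρ).map encodeEntry).drop (i + 1)), by simp [i.2.le], fun v => ?_⟩
  rw [← ofList_append_cons, encodePartial, ofFn_update, List.map_set,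
    List.set_eq_take_append_cons_drop]
  simp [i.2]

/-- The head of a task tells its kind: `nil` for a build task, a nonzero label for a node task. -/
def buildTask {n : ℕ} (ρ : Fin n → Option Bool) (d : ℕ) : Data :=
  .cons .nil (.cons (encodePartial ρ) (.num d))

def nodeTask {n : ℕ} (i : Fin n) : Data := .cons (.num (i + 1)) .nil

section Tasks

variable {n : ℕ} {ω : ℕ → Bool} {ans : Unit → Data → Data} (r : Regs) (m : ℕ → Data) (co : ℕ)
  (lg : List (Unit × Data))

lemma wp_leafProg {R : Data} {b : Bool} (hb : (m 0).truth = b) {φ : ℕ → State Unit → Prop}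
    (h : ∀ u ≤ 10, φ u ⟨toMem { r with
        nl := .nil,
        res := .cons (.cons .nil (.bit b)) R,
        t1 := .nil } m, co, lg⟩) :
    WP ans ω leafProg ⟨toMem { r with nl := .nil, res := R, t1 := .nil } m, co, lg⟩ φ := by
  simp only [leafProg, wp_seq, wp_ite, toMem_simReg, hb]
  cases b
  · simpa using h _ (by norm_num)
  · simpa using h _ (by norm_num)

lemma wp_truncProg {R : Data} {M c : ℕ} {φ : ℕ → State Unit → Prop}
    (h : φ (3 * M + 5) ⟨toMem { r with
        nl := .nil,
        mm := .num M,
        cnt := .num (c + M),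
        res := .cons (.cons .nil .nil) R,
        t1 := .nil } m, co, lg⟩) :
    WP ans ω truncProg ⟨toMem { r with
        nl := .nil,
        mm := .num M,
        cnt := .num c,
        res := R,
        t1 := .nil } m, co, lg⟩ φ := by
  simp only [truncProg, wp_seq, wp_copy, toMem_mm, update_toMem_t1]
  refine wp_count_loop { r with mm := .num M, res := R } _ _ _ M c ?_
  simp
  convert h using 1
  ring

lemma wp_expandProg {T : Data} (ρ : Fin n → Option Bool) (i : Fin n) (d : ℕ)
    {φ : ℕ → State Unit → Prop}
    (h : ∀ u ≤ 10 * n + 30, ∀ a, φ u ⟨toMem { r with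
        nl := .nil,
        fst := encodeCoord (some i),
        arr := a,
        tdep := .num d,
        tasks := .cons (buildTask (Function.update ρ i (some false)) d)
          (.cons (buildTask (Function.update ρ i (some true)) d) (.cons (nodeTask i) T)),
        t1 := .nil,
        t2 := .nil,
        t3 := .nil,
        t4 := .nil } m, co, lg⟩) :
    WP ans ω expandProg ⟨toMem { r with
        nl := .nil,
        fst := encodeCoord (some i),
        arr := encodePartial ρ,
        tdep := .num (d + 1),
        tasks := T,
        t1 := .nil,
        t2 := .nil,
        t3 := .nil,
        t4 := .nil } m, co, lg⟩ φ := by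
  obtain ⟨l, a, hl, hρ⟩ := exists_encodePartial_update ρ i
  have hi := i.2
  have hρ' := hρ (ρ i)
  rw [Function.update_eq_self] at hρ'
  simp only [buildTask, nodeTask, hρ, encodeCoord, ← hl, Data.num_succ] at h
  rw [hρ']
  simp only [expandProg, wp_seq, wp_cons, wp_tail, toMem_fst, toMem_nl, toMem_tasks, toMem_tdep,
    update_toMem_t2, update_toMem_tasks, update_toMem_tdep, update_toMem_t1, encodeCoord, ← hl,
    Data.num_succ, Data.tail_cons, toMem_t2]
  refine wp_unzip_loop { r with
    nl := .nil
    fst := .cons .nil (.num l.length)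
    tdep := .num d
    tasks := .cons (.cons (.cons .nil (.num l.length)) .nil) T
    t4 := .nil } _ _ _ l _ _ _ fun d' => ?_
  simp
  refine wp_zip_loop { r with
    nl := .nil
    fst := .cons .nil (.num l.length)
    tdep := .num d
    tasks := .cons (.cons (.cons .nil (.num l.length)) .nil) T
    t1 := .nil } _ _ _ l _ _ _ fun d' => ?_
  simp
  exact h _ (by omega) _

end Tasks

/-! ### Building the tree of the strategy -/

/-- The runs of `S` with input `σ` and coins `ω` on the inputs `x` end within `q` steps in the
states `F x`. -/
def RunsTo {n : ℕ} (f : BoolFn n) (ω : ℕ → Bool) (S : Prog StrategyOracle) (σ : Data) (q : ℕ)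
    (F : (Fin n → Bool) → State StrategyOracle) : Prop :=
  ∀ x, ∃ t ≤ q, Exec (strategyAnswer f x) ω S (State.init σ) t (F x)

/-- Compare the run on `x` with the run on the zero completion: on the coordinates specified by `ρ`
their oracles agree. -/
lemma RunsTo.locallyDetermined {n : ℕ} {f : BoolFn n} {ω : ℕ → Bool} {S : Prog StrategyOracle}
    {σ : Data} {q : ℕ} {F : (Fin n → Bool) → State StrategyOracle} (h : RunsTo f ω S σ q F) :
    LocallyDetermined F := by
  intro ρ x hx
  obtain ⟨t, -, ht⟩ := h x
  obtain ⟨t', -, ht'⟩ := h (fill ρ)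
  rcases ht'.compare (ρ := ρ) (fun _ _ => strategyAnswer_congr (consistent_fill ρ) hx) ht rfl with
    ⟨h₁, h₂⟩ | ⟨i, h₁, h₂⟩
  · exact .inl ⟨h₂, h₁.symm⟩
  · exact .inr ⟨i, h₁, (firstUnset_spec h₁).1, mem_revealed_of_firstUnset h₂⟩

/-- The learner's registers between two tasks. -/
def workRegs (r : Regs) (ω : ℕ → Bool) (M : ℕ) (σ T R : Data) (c j k : ℕ) : Regs :=
  { r with
    nl := .nil
    mm := .num M
    sin := σ
    tasks := T
    res := R
    cnt := .num c
    used := usedCoins ω j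
    rem := spareCoins ω j k
    fst := .nil
    arr := .nil
    tdep := .nil
    t1 := .nil
    t2 := .nil
    t3 := .nil
    t4 := .nil }

/-- The learner is between two tasks, with tasks `T`, results `R` and count `c`. -/
def WorkState (S : Prog StrategyOracle) (q : ℕ) (r : Regs) (ω : ℕ → Bool) (M : ℕ) (σ T R : Data)
    (c : ℕ) (z : State Unit) : Prop :=
  ∃ (m : ℕ → Data) (lg : List (Unit × Data)) (j k : ℕ), j ≤ q ∧ (∀ v > S.regBound, m v = .nil) ∧
    z = ⟨toMem (workRegs r ω M σ T R c j k) m, j + k, lg⟩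

/-- The time for one task. -/
def taskTime (b n M A q : ℕ) : ℕ := q * (4 * (A + q) + 24) + b + 3 * M + 10 * n + 100

section Build

variable {n : ℕ} {f : BoolFn n} {ω : ℕ → Bool} {S : Prog StrategyOracle} {σ : Data} {q A M : ℕ}
  {F : (Fin n → Bool) → State StrategyOracle} {r : Regs}

/-- Rewinding and clearing restore the initial state with all tossed coins spare. Hence every run
uses `ω` from index `0`, and all runs are values of one `F`. -/
lemma wp_runProg (hF : RunsTo f ω S σ q F) (hσ : σ.height ≤ A) (ρ : Fin n → Option Bool)
    {j k : ℕ} (hj : j ≤ q) {m : ℕ → Data} (hm : ∀ v > S.regBound, m v = .nil)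
    (lg : List (Unit × Data)) {φ : ℕ → State Unit → Prop}
    (h : ∀ u ≤ q * (4 * (A + q) + 24) + S.regBound + 10, ∀ j' ≤ q, ∀ k' lg',
      φ u ⟨toMem { r with
        nl := .nil,
        sin := σ,
        used := usedCoins ω j',
        rem := spareCoins ω j' k',
        fst := encodeCoord (nextQuery F ρ),
        arr := encodePartial ρ,
        t1 := .nil,
        t2 := .nil,
        t3 := .nil } (F (fill ρ)).mem, j' + k', lg'⟩) :
    WP (learnerAnswer f) ω (runProg S) ⟨toMem { r with
        nl := .nil,
        sin := σ,
        used := usedCoins ω j,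
        rem := spareCoins ω j k,
        arr := encodePartial ρ,
        t1 := .nil,
        t2 := .nil,
        t3 := .nil } m, j + k, lg⟩ φ := by
  obtain ⟨t, htq, ht⟩ := hF (fill ρ)
  simp only [runProg, wp_seq]
  refine wp_rewind { r with
    nl := .nil
    sin := σ
    arr := encodePartial ρ
    t2 := .nil
    t3 := .nil } _ _ _ j k ?_ .nil
  simp only [wp_setNil, update_toMem_fst]
  refine wp_clearRegs _ _ _ _ _ ?_
  simp only [wp_copy, toMem_sin, update_toMem_simReg]
  have hinit : Function.update (fun v => if v < S.regBound + 1 then Data.nil else m v) 0 σ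
      = (State.init σ : State StrategyOracle).mem := by
    funext v
    by_cases hv : v = 0
    · subst hv; simp [State.init]
    · by_cases hv' : v < S.regBound + 1
      · simp only [State.init, Function.update_of_ne hv, if_pos hv', if_neg hv]
      · simp [State.init, hv, hv', hm v (by omega)]
  rw [hinit]
  have key := wp_simulate (f := f) { r with sin := σ } ht (A := A) (B := A + q) (fun v => ?_)
    (by omega) (j + k) lg
  · have hco : (State.init σ : State StrategyOracle).coins + (j + k) = j + k := by
      simp [State.init]
    rw [hco] at key
    refine key.mono ?_
    rintro u _ ⟨hu, k', lg', rfl⟩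
    refine h _ ?_ _ ?_ k' lg'
    · have h₁ := Nat.mul_le_mul_right (4 * (A + q) + 20) htq
      have h₂ : q * (4 * (A + q) + 24) = q * (4 * (A + q) + 20) + 4 * q := by ring
      omega
    · have := ht.coins_le.2
      simp only [State.init, zero_add] at this
      omega
  · simp only [State.init]
    split_ifs
    · exact hσ
    · simp [Data.height]

lemma wp_nodeTask {ans : Unit → Data → Data} {T R a b : Data} {c : ℕ} (i : Fin n)
    {z : State Unit} (hz : WorkState S q r ω M σ (.cons (nodeTask i) T) (.cons a (.cons b R)) c z) :
    WP ans ω (taskProg S) z fun u z' => u ≤ 20 ∧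
      WorkState S q r ω M σ T (.cons (.cons (.num (i + 1)) (.cons b a)) R) c z' := by
  obtain ⟨m, lg, j, k, hj, hm, rfl⟩ := hz
  simp only [taskProg, nodeProg, wp_seq, wp_head, wp_tail, wp_cons, wp_setNil, wp_ite, workRegs,
    toMem_tasks, nodeTask, update_toMem_t1, update_toMem_t2, toMem_t1, toMem_t2,
    update_toMem_tasks, Data.head_cons, Data.tail_cons, Data.num_succ, Data.truth_cons, if_true,
    toMem_res, update_toMem_res, toMem_t3, toMem_t4, update_toMem_t3, update_toMem_t4]
  exact ⟨by norm_num, m, lg, j, k, hj, hm, rfl⟩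

/-- The state that results from a task to build the tree for `ρ`. -/
def AfterBuild (S : Prog StrategyOracle) (q : ℕ) (r : Regs) (ω : ℕ → Bool) (M : ℕ) (σ T R : Data)
    (c : ℕ) (F : (Fin n → Bool) → State StrategyOracle) (ρ : Fin n → Option Bool) (z : State Unit) :
    ℕ → Prop
  | 0 => WorkState S q r ω M σ T (.cons (strategyTree F 0 ρ).encode R) (c + M * truncCount F 0 ρ) z
  | d + 1 =>
    match nextQuery F ρ with
    | none => WorkState S q r ω M σ T (.cons (strategyTree F (d + 1) ρ).encode R) c z
    | some i => WorkState S q r ω M σ (.cons (buildTask (Function.update ρ i (some false)) d)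
        (.cons (buildTask (Function.update ρ i (some true)) d) (.cons (nodeTask i) T))) R c z

lemma wp_buildTask (hF : RunsTo f ω S σ q F) (hσ : σ.height ≤ A) (ρ : Fin n → Option Bool) (d : ℕ)
    {T R : Data} {c : ℕ} {z : State Unit}
    (hz : WorkState S q r ω M σ (.cons (buildTask ρ d) T) R c z) :
    WP (learnerAnswer f) ω (taskProg S) z fun u z' => u ≤ taskTime S.regBound n M A q ∧
      AfterBuild S q r ω M σ T R c F ρ z' d := by
  obtain ⟨m, lg, j, k, hj, hm, rfl⟩ := hz
  simp only [taskProg, buildProg, wp_seq, wp_head, wp_tail, wp_setNil, wp_ite, workRegs,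
    toMem_tasks, buildTask, update_toMem_t1, update_toMem_t2, toMem_t1, toMem_t2,
    update_toMem_tasks, Data.head_cons, Data.tail_cons, Data.truth_nil, if_false,
    Bool.false_eq_true, toMem_arr, update_toMem_arr, toMem_tdep, update_toMem_tdep]
  have hm' : ∀ v > S.regBound, (F (fill ρ)).mem v = .nil := by
    intro v hv
    obtain ⟨t, -, ht⟩ := hF (fill ρ)
    rw [ht.mem_eq_of_regBound_le hv.le]
    simp [State.init, (Nat.zero_lt_of_lt hv).ne']
  refine wp_runProg (r := { r with
    mm := .num M
    tasks := T
    res := R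
    cnt := .num c
    fst := .nil
    tdep := .num d
    t4 := .nil }) hF hσ ρ hj hm lg ?_
  intro u hu j' hj' k' lg'
  simp only [toMem_fst]
  cases hnq : nextQuery F ρ with
  | none =>
    simp only [encodeCoord, Data.truth_nil, Bool.false_eq_true, if_false]
    refine wp_leafProg { r with
      mm := .num M
      sin := σ
      tasks := T
      cnt := .num c
      used := usedCoins ω j'
      rem := spareCoins ω j' k'
      fst := .nil
      arr := encodePartial ρ
      tdep := .num d
      t2 := .nil
      t3 := .nil
      t4 := .nil } _ _ _ rfl fun u' hu' => ?_
    simp only [wp_setNil, update_toMem_arr, update_toMem_tdep, update_toMem_fst]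
    refine ⟨by unfold taskTime; omega, ?_⟩
    cases d with
    | zero =>
      simp only [AfterBuild, strategyTree, truncCount, hnq, Option.isSome_none,
        Bool.false_eq_true, if_false, mul_zero, add_zero]
      exact ⟨_, lg', j', k', hj', hm', rfl⟩
    | succ d =>
      simp only [AfterBuild, strategyTree, hnq]
      exact ⟨_, lg', j', k', hj', hm', rfl⟩
  | some i =>
    simp only [encodeCoord, Data.num_succ, Data.truth_cons, if_true, wp_ite, toMem_tdep]
    cases d with
    | zero =>
      simp only [Data.num_zero, Data.truth_nil, Bool.false_eq_true, if_false]
      refine wp_truncProg { r with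
        sin := σ
        tasks := T
        used := usedCoins ω j'
        rem := spareCoins ω j' k'
        fst := encodeCoord (some i)
        arr := encodePartial ρ
        tdep := .nil
        t2 := .nil
        t3 := .nil
        t4 := .nil } _ _ _ ?_
      simp only [wp_setNil, update_toMem_arr, update_toMem_tdep, update_toMem_fst]
      refine ⟨by unfold taskTime; omega, ?_⟩
      simp only [AfterBuild, strategyTree, truncCount, hnq, Option.isSome_some, if_true, mul_one]
      exact ⟨_, lg', j', k', hj', hm', rfl⟩
    | succ d =>
      simp only [Data.num_succ, Data.truth_cons, if_true]
      refine wp_expandProg { r with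
        mm := .num M
        sin := σ
        res := R
        cnt := .num c
        used := usedCoins ω j'
        rem := spareCoins ω j' k' } _ _ _ ρ i d fun u' hu' a => ?_
      simp only [wp_setNil, update_toMem_arr, update_toMem_tdep, update_toMem_fst]
      refine ⟨by unfold taskTime; omega, ?_⟩
      simp only [AfterBuild, hnq]
      exact ⟨_, lg', j', k', hj', hm', rfl⟩

/-- Some number of iterations of the loop that carries out the tasks, in at most `B` steps. -/
def Iterates (ans : Unit → Data → Data) (ω : ℕ → Bool) (P : Prog Unit) (a B : ℕ)
    (z z' : State Unit) : Prop :=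
  ∃ t ≤ B, ∀ u z'', Exec ans ω (.while a P) z' u z'' → Exec ans ω (.while a P) z (t + u) z''

lemma Iterates.trans {ans : Unit → Data → Data} {P : Prog Unit} {a B B' : ℕ}
    {z₁ z₂ z₃ : State Unit} (h : Iterates ans ω P a B z₁ z₂) (h' : Iterates ans ω P a B' z₂ z₃) :
    Iterates ans ω P a (B + B') z₁ z₃ := by
  obtain ⟨t, ht, h⟩ := h
  obtain ⟨t', ht', h'⟩ := h'
  refine ⟨t + t', by omega, fun u z hu => ?_⟩
  rw [add_assoc]
  exact h _ _ (h' _ _ hu)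

lemma Iterates.mono {ans : Unit → Data → Data} {P : Prog Unit} {a B B' : ℕ} {z z' : State Unit}
    (h : Iterates ans ω P a B z z') (hB : B ≤ B') : Iterates ans ω P a B' z z' := by
  obtain ⟨t, ht, h⟩ := h
  exact ⟨t, ht.trans hB, h⟩

lemma iterates_of_wp {ans : Unit → Data → Data} {P : Prog Unit} {a B : ℕ} {z : State Unit}
    {p : State Unit → Prop} (ha : (z.mem a).truth = true)
    (h : WP ans ω P z fun u z' => u ≤ B ∧ p z') :
    ∃ z', Iterates ans ω P a (B + 1) z z' ∧ p z' := by
  obtain ⟨t, z', ht, hB, hp⟩ := h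
  refine ⟨z', ⟨t + 1, by omega, fun u z'' hu => ?_⟩, hp⟩
  have := Exec.while_true ha ht hu
  rwa [show t + u + 1 = t + 1 + u by ring] at this

lemma WorkState.truth_tasks {T R : Data} {c : ℕ} {z : State Unit} {a : Data}
    (h : WorkState S q r ω M σ (.cons a T) R c z) : (z.mem rTasks).truth = true := by
  obtain ⟨m, lg, j, k, -, -, rfl⟩ := h
  rfl

/-- Handling the build task is depth-first recursion on an explicit stack. The factor `a d = 2 ^ (d
+ 2) - 3` satisfies `a 0 = 1` and `a (d + 1) = 2 * a d + 3`, which covers two subtrees, one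
expansion and one join. -/
lemma iterates_build (hF : RunsTo f ω S σ q F) (hσ : σ.height ≤ A) (d : ℕ) :
    ∀ (ρ : Fin n → Option Bool) (T R : Data) (c : ℕ) (z : State Unit),
    WorkState S q r ω M σ (.cons (buildTask ρ d) T) R c z →
    ∃ z', Iterates (learnerAnswer f) ω (taskProg S) rTasks
        ((2 ^ (d + 2) - 3) * (taskTime S.regBound n M A q + 1)) z z' ∧
      WorkState S q r ω M σ T (.cons (strategyTree F d ρ).encode R) (c + M * truncCount F d ρ)
        z' := by
  induction d with
  | zero =>
    intro ρ T R c z hz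
    obtain ⟨z', h₁, h₂⟩ := iterates_of_wp hz.truth_tasks (wp_buildTask hF hσ ρ 0 hz)
    exact ⟨z', h₁.mono (by omega), h₂⟩
  | succ d ih =>
    intro ρ T R c z hz
    obtain ⟨z₁, h₁, h₂⟩ := iterates_of_wp hz.truth_tasks (wp_buildTask hF hσ ρ (d + 1) hz)
    have h1 : 4 ≤ 2 ^ (d + 2) := by
      have := Nat.one_le_two_pow (n := d); rw [pow_add]; omega
    have h2 : 2 ^ (d + 1 + 2) = 2 * 2 ^ (d + 2) := by ring
    cases hnq : nextQuery F ρ with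
    | none =>
      simp only [AfterBuild, hnq] at h₂
      refine ⟨z₁, h₁.mono (Nat.le_mul_of_pos_left _ (by omega)), ?_⟩
      simpa [truncCount, hnq] using h₂
    | some i =>
      simp only [AfterBuild, hnq] at h₂
      obtain ⟨z₂, h₃, h₄⟩ := ih _ _ _ _ _ h₂
      obtain ⟨z₃, h₅, h₆⟩ := ih _ _ _ _ _ h₄
      obtain ⟨z₄, h₇, h₈⟩ := iterates_of_wp h₆.truth_tasks
        (wp_nodeTask (ans := learnerAnswer f) i h₆)
      refine ⟨z₄, (((h₁.trans h₃).trans h₅).trans h₇).mono ?_, ?_⟩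
      · have h20 : 20 ≤ taskTime S.regBound n M A q := by unfold taskTime; omega
        obtain ⟨e, he⟩ := Nat.exists_eq_add_of_le h1
        rw [h2, he, show 4 + e - 3 = e + 1 by omega, show 2 * (4 + e) - 3 = 2 * e + 5 by omega]
        nlinarith
      · simp only [strategyTree, hnq, truncCount, DTree.encode]
        convert h₈ using 1
        ring

end Build

/-! ### Correctness of the learner -/

lemma wp_setupProg {ans : Unit → Data → Data} {ω : ℕ → Bool} (c n : ℕ) (ε δ : ℚ)
    {φ : ℕ → State Unit → Prop}
    (h : φ (((c + 3) * δ.den + 4) * ε.den + 3 * n + 18) ⟨toMem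
      { nl := .nil, mm := .num (ε.den * (δ.den * c)),
        sin := .cons (.num n) (.cons (.num 1) (.num (ε.den * (δ.den * c)))),
        flag := .cons .nil .nil, wid := .num 1,
        root := .ofList (List.replicate n (encodeEntry none)) } fun _ => .nil, 0, []⟩) :
    WP ans ω (setupProg c) (State.init (learnerInput n ε δ)) φ := by
  have hinit : (State.init (learnerInput n ε δ) : State Unit)
      = ⟨toMem { io := learnerInput n ε δ } fun _ => .nil, 0, []⟩ := by
    simp only [State.init, State.mk.injEq, and_true]
    funext v
    match v with
    | 0 | 1 | 2 | 3 | 4 | 5 | 6 | 7 | 8 | 9 | 10 | 11 | 12 | 13 | 14 | 15 | 16 | 17 | 18 | 19 => rfl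
    | w + 20 => rfl
  rw [hinit]
  simp only [setupProg, wp_seq, wp_head, wp_tail, wp_copy, toMem_io, update_toMem_io, toMem_t1,
    update_toMem_t1, toMem_t2, update_toMem_t2, toMem_t3, update_toMem_t3, toMem_t4,
    update_toMem_t4, learnerInput, Data.head_cons, Data.tail_cons, Data.rat]
  refine wp_product_loop
    { io := .cons (.cons (.num ε.num.toNat) (.num ε.den)) (.cons (.num δ.num.toNat) (.num δ.den)),
      t1 := .num n, t2 := .num n } _ _ _ c ε.den δ.den 0 ?_
  simp only [wp_cons, wp_copy, toMem_nl, update_toMem_flag, toMem_flag, update_toMem_wid, toMem_mm,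
    update_toMem_sin, toMem_t1, toMem_sin, update_toMem_t3, zero_add]
  refine wp_root_loop
    { io := .cons (.cons (.num ε.num.toNat) (.num ε.den)) (.cons (.num δ.num.toNat) (.num δ.den)),
      nl := .nil, mm := .num (ε.den * (δ.den * c)),
      sin := .cons (.num n) (.cons (.cons .nil .nil) (.num (ε.den * (δ.den * c)))),
      flag := .cons .nil .nil, wid := .cons .nil .nil, t1 := .num n, t4 := .num δ.den }
    _ _ _ (.cons (.cons .nil .nil) .nil) [] n ?_
  simp only [wp_setNil, update_toMem_t1, update_toMem_t3, update_toMem_t4, update_toMem_io,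
    List.append_nil]
  convert h using 1
  · ring
  · rfl

/-! ### One round, the search for the depth, and the whole learner -/

section Rounds

variable {n : ℕ} {f : BoolFn n} {ω : ℕ → Bool} {S : Prog StrategyOracle} {σ : Data} {q A M : ℕ}
  {F : (Fin n → Bool) → State StrategyOracle}

lemma encodePartial_none :
    encodePartial (fun _ : Fin n => none) = .ofList (List.replicate n (encodeEntry none)) := by
  rw [encodePartial, List.ofFn_const, List.map_replicate]

/-- The learner is about to build the tree of depth `d`. -/
def RoundState (n : ℕ) (S : Prog StrategyOracle) (q : ℕ) (ω : ℕ → Bool) (M : ℕ) (σ : Data) (d : ℕ)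
    (z : State Unit) : Prop :=
  ∃ R c, WorkState S q
    { root := encodePartial (fun _ : Fin n => none), dep := .num d, wid := .num (2 ^ d),
      flag := .cons .nil .nil } ω M σ .nil R c z

/-- A factor of the time for building the tree of depth `d`. -/
def roundTime (b n M A q : ℕ) : ℕ := 4 * taskTime b n M A q + 3 * M + 40

lemma wp_roundProg (hF : RunsTo f ω S σ q F) (hσ : σ.height ≤ A) {d : ℕ} {z : State Unit}
    (hz : RoundState n S q ω M σ d z) :
    WP (learnerAnswer f) ω (roundProg S) z fun u z' =>
      u ≤ 2 ^ d * roundTime S.regBound n M A q ∧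
      ((M * truncCount F d (fun _ => none) < 2 ^ d ∧ (z'.mem rFlag).truth = false ∧
        (z'.mem rRes).head = (strategyTree F d fun _ => none).encode) ∨
      (2 ^ d ≤ M * truncCount F d (fun _ => none) ∧ RoundState n S q ω M σ (d + 1) z')) := by
  obtain ⟨R, c, m, lg, j, k, hj, hm, rfl⟩ := hz
  simp only [roundProg, wp_seq, wp_cons, wp_setNil, workRegs, toMem_root, toMem_dep,
    update_toMem_t1, toMem_nl, toMem_t1, update_toMem_tasks, update_toMem_res, update_toMem_cnt]
  obtain ⟨z', ⟨t, ht, hz'⟩, m', lg', j', k', hj', hm', rfl⟩ := iterates_build (M := M)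
    (r := { root := encodePartial (fun _ : Fin n => none), dep := .num d,
            wid := .num (2 ^ d), flag := .cons .nil .nil }) hF hσ d
    (fun _ => none) .nil .nil 0 _ ⟨m, lg, j, k, hj, hm, rfl⟩
  refine ⟨t + 1, _, hz' _ _ (.while_false rfl), ?_⟩
  simp only [wp_copy, workRegs, toMem_cnt, update_toMem_t1, toMem_wid, update_toMem_t2, zero_add]
  refine wp_compare_loop
    { nl := .nil, mm := .num M, sin := σ, res := .cons (strategyTree F d fun _ => none).encode .nil,
      cnt := .num (M * truncCount F d fun _ => none), used := usedCoins ω j',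
      rem := spareCoins ω j' k', root := encodePartial (fun _ : Fin n => none), dep := .num d,
      wid := .num (2 ^ d), flag := .cons .nil .nil } _ _ _ (M * truncCount F d fun _ => none)
    (2 ^ d) ?_
  simp only [wp_ite, toMem_t2]
  -- The counter is in unary, so this bounds the time of the comparison.
  have hc : M * truncCount F d (fun _ => none) ≤ M * 2 ^ d :=
    Nat.mul_le_mul_left M (truncCount_le d _)
  have h1 := Nat.one_le_two_pow (n := d)
  have h4 : (2 ^ (d + 2) - 3) * (taskTime S.regBound n M A q + 1)
      ≤ 2 ^ d * (4 * taskTime S.regBound n M A q + 4) := by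
    calc _ ≤ 2 ^ (d + 2) * (taskTime S.regBound n M A q + 1) :=
          Nat.mul_le_mul_right _ (Nat.sub_le _ _)
      _ = _ := by ring
  have hR : 2 ^ d * roundTime S.regBound n M A q
      = 2 ^ d * (4 * taskTime S.regBound n M A q + 4) + 3 * (M * 2 ^ d) + 36 * 2 ^ d := by
    unfold roundTime; ring
  rcases lt_or_ge (M * truncCount F d fun _ => none) (2 ^ d) with hlt | hge
  · obtain ⟨e, he⟩ := Nat.exists_eq_add_of_lt hlt
    rw [show 2 ^ d - M * truncCount F d (fun _ => none) = e + 1 by omega]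
    simp only [Data.num_succ, Data.truth_cons, if_true, wp_setNil, update_toMem_flag,
      update_toMem_t2]
    refine ⟨by omega, .inl ⟨hlt, rfl, rfl⟩⟩
  · rw [Nat.sub_eq_zero_of_le hge]
    simp only [Data.num_zero, Data.truth_nil, Bool.false_eq_true, if_false, wp_cons, toMem_nl,
      toMem_dep, update_toMem_dep, wp_seq]
    refine wp_double_loop
      { nl := .nil, mm := .num M, sin := σ,
        res := .cons (strategyTree F d fun _ => none).encode .nil,
        cnt := .num (M * truncCount F d fun _ => none), used := usedCoins ω j',
        rem := spareCoins ω j' k', root := encodePartial (fun _ : Fin n => none),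
        dep := .num (d + 1), flag := .cons .nil .nil } _ _ _ (2 ^ d) 0 ?_
    simp only [wp_copy, toMem_t3, update_toMem_wid, wp_setNil, update_toMem_t3, update_toMem_t2,
      zero_add]
    refine ⟨by omega, .inr ⟨hge, .cons (strategyTree F d fun _ => none).encode .nil,
      M * truncCount F d fun _ => none, m', lg', j', k', hj', hm', ?_⟩⟩
    rw [pow_succ, mul_comm (2 ^ d) 2]
    rfl

/-- Any depth `d₀` that passes the test bounds the search. The loop may stop earlier, but whatever
depth it stops at has passed the test itself, which is all that accuracy needs. -/
lemma wp_roundLoop (hF : RunsTo f ω S σ q F) (hσ : σ.height ≤ A) {d₀ : ℕ}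
    (hd₀ : M * truncCount F d₀ (fun _ => none) < 2 ^ d₀) (e : ℕ) : ∀ {d : ℕ} {z : State Unit},
    d + e = d₀ → RoundState n S q ω M σ d z →
    WP (learnerAnswer f) ω (.while rFlag (roundProg S)) z fun u z' =>
      u ≤ (e + 1) * (2 ^ d₀ * roundTime S.regBound n M A q + 1) + 1 ∧
      ∃ d ≤ d₀, M * truncCount F d (fun _ => none) < 2 ^ d ∧
        (z'.mem rRes).head = (strategyTree F d fun _ => none).encode := by
  induction e with
  | zero =>
    intro d z hd hz
    rw [add_zero] at hd
    subst hd
    have hfl : (z.mem rFlag).truth = true := by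
      obtain ⟨R, c, m, lg, j, k, -, -, rfl⟩ := hz
      rfl
    rw [wp_while, if_pos hfl]
    refine (wp_roundProg hF hσ hz).mono ?_
    rintro u z' ⟨hu, ⟨h₁, h₂, h₃⟩ | ⟨h₁, -⟩⟩
    · rw [wp_while, if_neg (by simp [h₂])]
      exact ⟨by omega, d, le_rfl, h₁, h₃⟩
    · omega
  | succ e ih =>
    intro d z hd hz
    have hfl : (z.mem rFlag).truth = true := by
      obtain ⟨R, c, m, lg, j, k, -, -, rfl⟩ := hz
      rfl
    rw [wp_while, if_pos hfl]
    refine (wp_roundProg hF hσ hz).mono ?_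
    rintro u z' ⟨hu, h⟩
    have hu' : u ≤ 2 ^ d₀ * roundTime S.regBound n M A q :=
      hu.trans (Nat.mul_le_mul_right _ (Nat.pow_le_pow_right (by norm_num) (by omega)))
    rcases h with ⟨h₁, h₂, h₃⟩ | ⟨-, h₂⟩
    · rw [wp_while, if_neg (by simp [h₂])]
      refine ⟨?_, d, by omega, h₁, h₃⟩
      nlinarith
    · refine (ih (by omega) h₂).mono ?_
      rintro u' z'' ⟨hu'', hd⟩
      refine ⟨?_, hd⟩
      nlinarith

/-- A bound for the time of the learner that builds the tree of depth `d`. -/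
def learnTime (b c n a a' A q d : ℕ) : ℕ :=
  4 ^ d * (roundTime b n (a * (a' * c)) A q + ((c + 3) * a' + 4) * a + 3 * n + 30)

lemma wp_learner {c : ℕ} {ε δ : ℚ}
    (hF : RunsTo f ω S (.cons (.num n) (.cons (.num 1) (.num (ε.den * (δ.den * c))))) q F)
    (hA : n + ε.den * (δ.den * c) + 3 ≤ A) {d₀ : ℕ}
    (hd₀ : ε.den * (δ.den * c) * truncCount F d₀ (fun _ => none) < 2 ^ d₀) :
    WP (learnerAnswer f) ω (learner S c) (State.init (learnerInput n ε δ)) fun u z =>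
      u ≤ learnTime S.regBound c n ε.den δ.den A q d₀ ∧
      ∃ d ≤ d₀, ε.den * (δ.den * c) * truncCount F d (fun _ => none) < 2 ^ d ∧
        z.output = (strategyTree F d fun _ => none).encode := by
  simp only [learner, wp_seq]
  refine wp_setupProg c n ε δ ?_
  have hσ : (Data.cons (.num n) (.cons (.num 1) (.num (ε.den * (δ.den * c))))).height ≤ A := by
    simp only [Data.height, Data.height_num]
    omega
  refine (wp_roundLoop (d := 0) hF hσ hd₀ d₀ (zero_add _) ?_).mono ?_
  · refine ⟨.nil, 0, fun _ => .nil, [], 0, 0, Nat.zero_le _, fun _ _ => rfl, ?_⟩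
    rw [encodePartial_none]
    rfl
  · rintro u z ⟨hu, d, hd, h₁, h₂⟩
    simp only [wp_head]
    refine ⟨?_, d, hd, h₁, ?_⟩
    -- At most `d₀ + 1 ≤ 2 ^ d₀` rounds, each of time `2 ^ d₀` up to a factor independent of `d₀`:
    -- this is the origin of `4 ^ d₀`.
    · have h3 : d₀ + 1 ≤ 2 ^ d₀ := Nat.lt_two_pow_self
      have h4 : 4 ^ d₀ = 2 ^ d₀ * 2 ^ d₀ := by rw [← mul_pow]; norm_num
      have h5 := Nat.one_le_two_pow (n := d₀)
      have h6 : (d₀ + 1) * (2 ^ d₀ * roundTime S.regBound n (ε.den * (δ.den * c)) A q + 1)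
          ≤ 2 ^ d₀ * (2 ^ d₀ * roundTime S.regBound n (ε.den * (δ.den * c)) A q + 2 ^ d₀) :=
        Nat.mul_le_mul h3 (by omega)
      have h7 : 1 ≤ 4 ^ d₀ := Nat.one_le_pow _ _ (by norm_num)
      have h8 : ((c + 3) * δ.den + 4) * ε.den + 3 * n + 29
          ≤ 4 ^ d₀ * (((c + 3) * δ.den + 4) * ε.den + 3 * n + 29) :=
        Nat.le_mul_of_pos_left _ h7
      have h9 : learnTime S.regBound c n ε.den δ.den A q d₀
          = 2 ^ d₀ * (2 ^ d₀ * roundTime S.regBound n (ε.den * (δ.den * c)) A q + 2 ^ d₀)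
            + 4 ^ d₀ * (((c + 3) * δ.den + 4) * ε.den + 3 * n + 29) := by
        unfold learnTime
        rw [h4]
        ring
      omega
    · simp [State.output, rIo, h₂]

end Rounds

/-! ### Growth rates -/

/-- Take the supremum of `g` over `[0, b]`, cut below at zero. The part of the interval below a
threshold contributes a constant, the part above at most `η * b`. -/
lemma exists_monotone_majorant {g : ℝ → ℝ} (hg : g =o[Filter.atTop] fun u : ℝ => u)
    (hb : ∀ b : ℝ, BddAbove (g '' Set.Icc 0 b)) :
    ∃ G : ℝ → ℝ, (∀ b, 0 ≤ G b) ∧ (∀ u b, 0 ≤ u → u ≤ b → g u ≤ G b) ∧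
      G =o[Filter.atTop] fun u : ℝ => u := by
  refine ⟨fun b => max 0 (sSup (g '' Set.Icc 0 b)), fun b => le_max_left _ _,
    fun u b h₀ h₁ => le_max_of_le_right (le_csSup (hb b) ⟨u, ⟨h₀, h₁⟩, rfl⟩), ?_⟩
  rw [Asymptotics.isLittleO_iff] at hg ⊢
  intro η hη
  obtain ⟨u₀, hu₀⟩ := Filter.eventually_atTop.1 (hg hη)
  obtain ⟨B, hB⟩ := hb u₀
  filter_upwards [Filter.eventually_ge_atTop u₀, Filter.eventually_ge_atTop (B / η),
    Filter.eventually_ge_atTop 0] with b h₁ h₂ h₃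
  rw [div_le_iff₀ hη] at h₂
  rw [Real.norm_of_nonneg (le_max_left _ _), Real.norm_of_nonneg h₃]
  refine max_le (by positivity) (csSup_le ⟨_, 0, ⟨le_rfl, h₃⟩, rfl⟩ ?_)
  rintro _ ⟨u, ⟨hu, hub⟩, rfl⟩
  rcases le_total u u₀ with h | h
  · exact (hB ⟨u, ⟨hu, h⟩, rfl⟩).trans (by linarith)
  · have := (le_abs_self _).trans (hu₀ u h)
    rw [Real.norm_of_nonneg hu] at this
    exact this.trans (mul_le_mul_of_nonneg_left hub hη.le)

/-- An upper bound for the binary logarithm of `n ^ k + k`. -/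
def logSize (k n : ℕ) : ℝ := (k + 1) * (Real.log n / Real.log 2 + 1)

lemma one_le_logSize (k n : ℕ) : 1 ≤ logSize k n := by
  have h₁ : 0 ≤ Real.log n / Real.log 2 := div_nonneg (Real.log_natCast_nonneg n)
    (Real.log_nonneg (by norm_num))
  have h₂ : (0 : ℝ) ≤ k := Nat.cast_nonneg k
  unfold logSize
  nlinarith

/-- From `n ^ k + k ≤ (max n 1) ^ k * 2 ^ k`. -/
lemma logb_le_logSize (k n : ℕ) : Real.logb 2 ((n ^ k + k : ℕ) : ℝ) ≤ logSize k n := by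
  have hN : 1 ≤ max n 1 := le_max_right _ _
  -- For `n = 0` both sides vanish, as `Real.log 0 = 0`.
  have hlog : Real.log n = Real.log ((max n 1 : ℕ) : ℝ) := by
    rcases Nat.eq_zero_or_pos n with rfl | h
    · simp
    · rw [max_eq_left h]
  have h₁ : n ^ k + k ≤ (max n 1) ^ k * 2 ^ k := by
    have h₂ : n ^ k ≤ (max n 1) ^ k := Nat.pow_le_pow_left (le_max_left _ _) k
    have h₃ : 1 ≤ (max n 1) ^ k := Nat.one_le_pow _ _ hN
    have h₄ : k + 1 ≤ 2 ^ k := Nat.lt_two_pow_self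
    nlinarith
  have hpos : 0 < n ^ k + k := by
    rcases Nat.eq_zero_or_pos k with rfl | h
    · simp
    · omega
  have hN' : (0 : ℝ) < (max n 1 : ℕ) := by exact_mod_cast hN
  have h₅ : Real.logb 2 ((n ^ k + k : ℕ) : ℝ)
      ≤ Real.logb 2 (((max n 1 : ℕ) : ℝ) ^ k * 2 ^ k) := by
    refine Real.logb_le_logb_of_le (by norm_num) (by exact_mod_cast hpos) ?_
    exact_mod_cast h₁
  rw [Real.logb_mul (by positivity) (by positivity), Real.logb_pow, Real.logb_pow,
    Real.logb_self_eq_one (by norm_num), show Real.logb 2 ((max n 1 : ℕ) : ℝ)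
      = Real.log n / Real.log 2 by rw [hlog]; rfl] at h₅
  have h₆ : 0 ≤ Real.log n / Real.log 2 := div_nonneg (Real.log_natCast_nonneg n)
    (Real.log_nonneg (by norm_num))
  unfold logSize
  linarith

lemma tendsto_log_natCast : Filter.Tendsto (fun n : ℕ => Real.log n) Filter.atTop Filter.atTop :=
  Real.tendsto_log_atTop.comp tendsto_natCast_atTop_atTop

lemma const_isLittleO_log (a : ℝ) :
    (fun _ : ℕ => a) =o[Filter.atTop] fun n : ℕ => Real.log n :=
  Asymptotics.isLittleO_const_left.2
    (.inr (Filter.tendsto_abs_atTop_atTop.comp tendsto_log_natCast))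

lemma log_isLittleO_sq :
    (fun n : ℕ => Real.log n) =o[Filter.atTop] fun n : ℕ => Real.log n * Real.log n := by
  have := (const_isLittleO_log 1).mul_isBigO
    (Asymptotics.isBigO_refl (fun n : ℕ => Real.log n) Filter.atTop)
  simpa using this

lemma tendsto_logSize (k : ℕ) : Filter.Tendsto (logSize k) Filter.atTop Filter.atTop := by
  unfold logSize
  refine Filter.Tendsto.const_mul_atTop (by positivity) (Filter.tendsto_atTop_add_const_right _ _ ?_)
  exact tendsto_log_natCast.atTop_div_const (Real.log_pos (by norm_num))

lemma logSize_isBigO (k : ℕ) : logSize k =O[Filter.atTop] fun n : ℕ => Real.log n := by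
  unfold logSize
  refine Asymptotics.IsBigO.const_mul_left (Asymptotics.IsBigO.add ?_
    (const_isLittleO_log 1).isBigO) _
  simp only [div_eq_inv_mul]
  exact (Asymptotics.isBigO_refl _ _).const_mul_left _

lemma logSize_mul_isLittleO {G : ℝ → ℝ} (hG : G =o[Filter.atTop] fun u : ℝ => u) (k : ℕ) :
    (fun n => logSize k n * G (logSize k n)) =o[Filter.atTop]
      fun n : ℕ => Real.log n * Real.log n :=
  (logSize_isBigO k).mul_isLittleO
    ((hG.comp_tendsto (tendsto_logSize k)).trans_isBigO (logSize_isBigO k))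

lemma eval_le_mul_pow (P : Polynomial ℕ) {n : ℕ} (hn : 1 ≤ n) :
    P.eval n ≤ P.eval 1 * n ^ P.natDegree := by
  rw [Polynomial.eval_eq_sum_range, Polynomial.eval_eq_sum_range, Finset.sum_mul]
  refine Finset.sum_le_sum fun i hi => ?_
  rw [one_pow, mul_one]
  exact Nat.mul_le_mul_left _ (Nat.pow_le_pow_right hn (Nat.lt_succ_iff.1 (Finset.mem_range.1 hi)))

lemma log_eval_isBigO (P : Polynomial ℕ) (hP : ∀ n : ℕ, 1 ≤ P.eval n) :
    (fun n : ℕ => Real.log (P.eval n : ℕ)) =O[Filter.atTop] fun n : ℕ => Real.log n := by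
  have h : (fun n : ℕ => Real.log (P.eval 1 : ℕ) + P.natDegree * Real.log n)
      =O[Filter.atTop] fun n : ℕ => Real.log n :=
    (const_isLittleO_log _).isBigO.add ((Asymptotics.isBigO_refl _ _).const_mul_left _)
  refine Asymptotics.IsBigO.trans (Asymptotics.IsBigO.of_bound 1 ?_) h
  filter_upwards [Filter.eventually_ge_atTop 1] with n hn
  have h₁ : (0 : ℝ) < (P.eval n : ℕ) := by exact_mod_cast hP n
  have h₂ : (0 : ℝ) < (P.eval 1 : ℕ) := by exact_mod_cast hP 1
  have h₃ : (0 : ℝ) < n := by exact_mod_cast hn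
  have h₄ : Real.log (P.eval n : ℕ) ≤ Real.log (P.eval 1 : ℕ) + P.natDegree * Real.log n := by
    rw [← Real.log_pow, ← Real.log_mul (by positivity) (by positivity)]
    refine Real.log_le_log h₁ ?_
    exact_mod_cast eval_le_mul_pow P hn
  have h₅ : 0 ≤ Real.log (P.eval n : ℕ) := Real.log_natCast_nonneg _
  rw [one_mul, Real.norm_of_nonneg h₅, Real.norm_of_nonneg (h₅.trans h₄)]
  exact h₄

/-- Functions `4 ^ o(log ^ 2 n) * poly(n)` are of the form `n ^ o(log n)`. -/
lemma exists_exponent (P : Polynomial ℕ) (hP : ∀ n : ℕ, 1 ≤ P.eval n) (d : ℕ → ℕ)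
    (hd : (fun n => (d n : ℝ)) =o[Filter.atTop] fun n : ℕ => Real.log n * Real.log n) :
    ∃ r : ℕ → ℝ, r =o[Filter.atTop] (fun n : ℕ => Real.log n) ∧
      ∀ᶠ n : ℕ in Filter.atTop, ((4 ^ d n * P.eval n : ℕ) : ℝ) ≤ (n : ℝ) ^ r n := by
  have hpos : ∀ n, (0 : ℝ) < (P.eval n : ℕ) := fun n => by exact_mod_cast hP n
  have hlog : (fun n => Real.log ((4 ^ d n * P.eval n : ℕ) : ℝ)) =o[Filter.atTop]
      fun n : ℕ => Real.log n * Real.log n := by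
    have h : ∀ n, Real.log ((4 ^ d n * P.eval n : ℕ) : ℝ)
        = Real.log 4 * d n + Real.log (P.eval n : ℕ) := by
      intro n
      push_cast
      rw [Real.log_mul (by positivity) (hpos n).ne', Real.log_pow]
      ring
    simp only [h]
    exact (hd.const_mul_left _).add ((log_eval_isBigO P hP).trans_isLittleO log_isLittleO_sq)
  have hne : ∀ᶠ n : ℕ in Filter.atTop, Real.log n ≠ 0 :=
    tendsto_log_natCast.eventually_ne_atTop 0
  -- The exponent is the logarithm to base `n`, so the bound holds with equality once `log n ≠ 0`.
  refine ⟨fun n => Real.log ((4 ^ d n * P.eval n : ℕ) : ℝ) * (Real.log n)⁻¹, ?_, ?_⟩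
  · refine (hlog.mul_isBigO (Asymptotics.isBigO_refl (fun n : ℕ => (Real.log n)⁻¹)
      Filter.atTop)).trans_eventuallyEq ?_
    filter_upwards [hne] with n hn
    field_simp
  · filter_upwards [hne, Filter.eventually_ge_atTop 1] with n hn hn'
    have h₃ : (0 : ℝ) < n := by exact_mod_cast hn'
    have h₄ : (0 : ℝ) < ((4 ^ d n * P.eval n : ℕ) : ℝ) := by
      push_cast
      have := hpos n
      positivity
    rw [Real.rpow_def_of_pos h₃, mul_left_comm, mul_inv_cancel₀ hn, mul_one, Real.exp_log h₄]

/-! ### Coins -/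

/-- Such a function factors through the finite discrete space of the first `q` coins. -/
lemma measurable_of_prefix {β : Type*} [MeasurableSpace β] (q : ℕ) {φ : (ℕ → Bool) → β}
    (h : ∀ ω ω' : ℕ → Bool, (∀ i < q, ω i = ω' i) → φ ω = φ ω') : Measurable φ := by
  have e : φ = (fun b : Fin q → Bool => φ fun i => if h : i < q then b ⟨i, h⟩ else false) ∘
      fun ω i => ω i := by
    funext ω
    exact h _ _ fun i hi => by simp [hi]
  rw [e]
  exact (measurable_of_finite _).comp (measurable_pi_lambda _ fun i => measurable_pi_apply _)

instance : MeasureTheory.IsProbabilityMeasure coinLaw := by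
  unfold coinLaw
  infer_instance

lemma coinLaw_markov {φ : (ℕ → Bool) → ℝ≥0∞} (hφ : Measurable φ) {a b c : ℝ} (hb : 0 < b)
    (h : ∫⁻ ω, φ ω ∂coinLaw ≤ ENNReal.ofReal a) (hab : a ≤ c * b) :
    coinLaw {ω | ENNReal.ofReal b ≤ φ ω} ≤ ENNReal.ofReal c := by
  have hb' : ENNReal.ofReal b ≠ 0 := by simpa using hb
  refine (MeasureTheory.meas_ge_le_lintegral_div hφ.aemeasurable hb' ENNReal.ofReal_ne_top).trans ?_
  rw [ENNReal.div_le_iff hb' ENNReal.ofReal_ne_top, ← ENNReal.ofReal_mul' hb.le]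
  exact h.trans (ENNReal.ofReal_le_ofReal hab)

lemma RunsTo.eq_of_prefix {n : ℕ} {f : BoolFn n} {ω ω' : ℕ → Bool} {S : Prog StrategyOracle}
    {σ : Data} {q : ℕ} {F F' : (Fin n → Bool) → State StrategyOracle} (h : RunsTo f ω S σ q F)
    (h' : RunsTo f ω' S σ q F') (hω : ∀ i < q, ω i = ω' i) (x : Fin n → Bool) : F x = F' x := by
  obtain ⟨t, htq, ht⟩ := h x
  obtain ⟨t', -, ht'⟩ := h' x
  have hc := ht.coins_le.2
  simp only [State.init, zero_add] at hc
  exact ((ht.congr_coins fun i hi => (hω i (hi.trans_le (hc.trans htq))).symm).unique ht').2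

/-! ### From strategies to learners -/

/-! ### Truncation and error for fixed coins -/

section Quality

variable {n : ℕ} {f : BoolFn n} {F : (Fin n → Bool) → State StrategyOracle}

/-- Markov's inequality over the inputs: a truncated input reveals at least `d + 1` coordinates, so
the truncated fraction is at most `a / (d + 1)`. The gain of one over `d ≥ M * a` makes the result
strict. -/
lemma truncCount_mul_lt (hF : LocallyDetermined F) {M d : ℕ} {a : ℝ}
    (h : (∑ x, ((revealed n (F x)).card : ℝ)) / 2 ^ n < a) (had : M * a ≤ d) :
    M * truncCount F d (fun _ => none) < 2 ^ d := by
  classical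
  have hT := card_truncated_root hF d
  set Tr := Finset.univ.filter fun x => Truncated F x d fun _ => none with hTr
  have h₁ : (Tr.card : ℝ) * (d + 1) ≤ ∑ x, ((revealed n (F x)).card : ℝ) := by
    have h₂ : Tr.card * (d + 1) ≤ ∑ x ∈ Tr, (revealed n (F x)).card := by
      rw [← smul_eq_mul]
      refine Finset.card_nsmul_le_sum _ _ _ fun x hx => ?_
      have hx' : Truncated F x d fun _ => none := by simpa [hTr] using hx
      have := lt_card_revealed_of_truncated hF d (fun i b h => by simp at h) hx'
      simpa using this
    have h₃ : ∑ x ∈ Tr, (revealed n (F x)).card ≤ ∑ x, (revealed n (F x)).card :=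
      Finset.sum_le_sum_of_subset (Finset.subset_univ _)
    exact_mod_cast h₂.trans h₃
  rw [div_lt_iff₀ (by positivity)] at h
  have hpos : (0 : ℝ) < 2 ^ n := by positivity
  have h₄ : (M : ℝ) * Tr.card < 2 ^ n := by
    have h₅ : (M : ℝ) * (Tr.card * (d + 1)) ≤ M * (a * 2 ^ n) :=
      mul_le_mul_of_nonneg_left (h₁.trans h.le) (Nat.cast_nonneg M)
    have h₆ : (M : ℝ) * (a * 2 ^ n) ≤ d * 2 ^ n := by
      rw [← mul_assoc]
      exact mul_le_mul_of_nonneg_right had hpos.le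
    have h₇ : (0 : ℝ) ≤ d := Nat.cast_nonneg d
    by_contra hcon
    push Not at hcon
    nlinarith
  have h₅ : M * Tr.card < 2 ^ n := by exact_mod_cast h₄
  have h₆ : M * truncCount F d (fun _ => none) * 2 ^ n < 2 ^ d * 2 ^ n := by
    rw [mul_assoc, ← hT, ← mul_assoc, mul_comm (2 ^ d)]
    exact Nat.mul_lt_mul_of_pos_right h₅ (by positivity)
  exact Nat.lt_of_mul_lt_mul_right h₆

/-- The tree errs only where the strategy with these coins errs or where the input is truncated; the
latter fraction is below `1 / M ≤ b`. -/
lemma disagreement_strategyTree_le (hF : LocallyDetermined F) {M d : ℕ} {a b : ℝ}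
    (herr : disagreement (fun x => (F x).output.truth) f < a) (hM : 1 ≤ M * b)
    (hd : M * truncCount F d (fun _ => none) < 2 ^ d) :
    disagreement (strategyTree F d fun _ => none).eval f ≤ a + b := by
  classical
  have hT := card_truncated_root hF d
  set Tr := Finset.univ.filter fun x => Truncated F x d fun _ => none with hTr
  have hsub : (Finset.univ.filter fun x => (strategyTree F d fun _ => none).eval x ≠ f x).card
      ≤ (Finset.univ.filter fun x => (F x).output.truth ≠ f x).card + Tr.card := by
    refine (Finset.card_le_card ?_).trans (Finset.card_union_le _ _)
    intro x hx
    simp only [Finset.mem_filter, Finset.mem_univ, true_and, Finset.mem_union, hTr] at hx ⊢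
    by_cases ht : Truncated F x d fun _ => none
    · exact .inr ht
    · rw [eval_strategyTree hF d (fun i b h => by simp at h) ht] at hx
      exact .inl hx
  have hpos : (0 : ℝ) < 2 ^ n := by positivity
  have hTr' : (Tr.card : ℝ) / 2 ^ n ≤ b := by
    have h₁ : M * Tr.card < 2 ^ n := by
      have : M * Tr.card * 2 ^ d < 2 ^ n * 2 ^ d := by
        rw [mul_assoc, hT, ← mul_assoc, mul_comm (2 ^ n)]
        exact Nat.mul_lt_mul_of_pos_right hd (by positivity)
      exact Nat.lt_of_mul_lt_mul_right this
    have h₂ : (M : ℝ) * Tr.card < 2 ^ n := by exact_mod_cast h₁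
    have h₃ : (0 : ℝ) ≤ Tr.card := Nat.cast_nonneg _
    rw [div_le_iff₀ hpos]
    have hM' : (0 : ℝ) < M := by
      rcases Nat.eq_zero_or_pos M with rfl | h
      · norm_num at hM
      · exact_mod_cast h
    have hb : 0 < b := by
      by_contra hcon
      push Not at hcon
      nlinarith
    nlinarith
  have hsub' : disagreement (strategyTree F d fun _ => none).eval f
      ≤ disagreement (fun x => (F x).output.truth) f + (Tr.card : ℝ) / 2 ^ n := by
    unfold disagreement
    rw [← add_div]
    refine div_le_div_of_nonneg_right ?_ hpos.le
    exact_mod_cast hsub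
  linarith

end Quality

/-- The fraction `1 / M` is in lowest terms, so the learner can write the input of the strategy
without reducing anything. -/
lemma strategyInput_inv (n : ℕ) {M : ℕ} (hM : M ≠ 0) :
    strategyInput n ((M : ℚ)⁻¹) = .cons (.num n) (.cons (.num 1) (.num M)) := by
  simp [strategyInput, Data.rat, Rat.inv_natCast_num_of_pos (Nat.pos_of_ne_zero hM),
    Rat.inv_natCast_den_of_pos (Nat.pos_of_ne_zero hM)]

/-- The expected cost of a strategy that is efficient on small trees is `o(log ^ 2 n)`. -/
lemma cost_le_logSize {n k : ℕ} {f : BoolFn n} (hf : HasTreeOfSize f (n ^ k + k)) {ε : ℝ}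
    {g G : ℝ → ℝ}
    (hG : ∀ u b, 0 ≤ u → u ≤ b → g u ≤ G b) {a : ℝ≥0∞}
    (ha : a ≤ max 1 (opt f (fun _ => 1) ε) * ENNReal.ofReal (g (totalInfluence f))) :
    a ≤ ENNReal.ofReal (logSize k n * G (logSize k n)) := by
  obtain ⟨h₁, h₂⟩ := exists_average_depth_bound hf ε
  have h₃ := logb_le_logSize k n
  have h₄ := one_le_logSize k n
  refine ha.trans ?_
  rw [ENNReal.ofReal_mul (by linarith)]
  refine mul_le_mul' (max_le ?_ (h₁.trans (ENNReal.ofReal_le_ofReal h₃)))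
    (ENNReal.ofReal_le_ofReal (hG _ _ (totalInfluence_nonneg f) (h₂.trans h₃)))
  rw [← ENNReal.ofReal_one]
  exact ENNReal.ofReal_le_ofReal h₄

/-- With high probability over its coins, a strategy of small error and cost has small error and
cost for these coins. -/
lemma coinLaw_good {n : ℕ} {f : BoolFn n} {S : Prog StrategyOracle} {σ : Data} {q : ℕ}
    {final : (Fin n → Bool) → (ℕ → Bool) → State StrategyOracle}
    (hF : ∀ ω, RunsTo f ω S σ q fun x => final x ω) {e D a b δ : ℝ} (ha : 0 < a) (hb : 0 < b)
    (he : (∑ x, coinLaw {ω | (final x ω).output.truth ≠ f x}) / 2 ^ n ≤ ENNReal.ofReal e)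
    (hD : (∑ x, ∫⁻ ω, ((revealed n (final x ω)).card : ℝ≥0∞) ∂coinLaw) / 2 ^ n
      ≤ ENNReal.ofReal D) (hea : e ≤ δ / 2 * a) (hDb : D ≤ δ / 2 * b) (hδ : 0 ≤ δ) :
    ENNReal.ofReal (1 - δ) ≤ coinLaw {ω |
      disagreement (fun x => (final x ω).output.truth) f < a ∧
      (∑ x, ((revealed n (final x ω)).card : ℝ)) / 2 ^ n < b} := by
  have hprefix : ∀ ω ω' : ℕ → Bool, (∀ i < q, ω i = ω' i) → ∀ x, final x ω = final x ω' :=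
    fun ω ω' h => (hF ω).eq_of_prefix (hF ω') h
  have hpow : (2 : ℝ≥0∞) ^ n ≠ 0 := by positivity
  have hE : Measurable fun ω =>
      ENNReal.ofReal (disagreement (fun x => (final x ω).output.truth) f) :=
    measurable_of_prefix q fun ω ω' h => by simp only [hprefix ω ω' h]
  have hC : Measurable fun ω =>
      ENNReal.ofReal ((∑ x, ((revealed n (final x ω)).card : ℝ)) / 2 ^ n) :=
    measurable_of_prefix q fun ω ω' h => by simp only [hprefix ω ω' h]
  have hE' : ∫⁻ ω, ENNReal.ofReal (disagreement (fun x => (final x ω).output.truth) f) ∂coinLaw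
      ≤ ENNReal.ofReal e := by
    refine le_trans (le_of_eq ?_) he
    have h₁ : ∀ ω, ENNReal.ofReal (disagreement (fun x => (final x ω).output.truth) f)
        = (∑ x, Set.indicator {ω | (final x ω).output.truth ≠ f x} 1 ω) * (2 ^ n)⁻¹ := by
      intro ω
      rw [disagreement, ENNReal.ofReal_div_of_pos (by positivity), ENNReal.ofReal_natCast,
        Finset.card_filter, ENNReal.ofReal_pow (by norm_num), div_eq_mul_inv]
      congr 1
      · push_cast
        refine Finset.sum_congr rfl fun x _ => ?_
        simp [Set.indicator_apply]
      · simp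
    have hm : ∀ x, MeasurableSet {ω | (final x ω).output.truth ≠ f x} := fun x => by
      have : Measurable fun ω => (final x ω).output.truth :=
        measurable_of_prefix q fun ω ω' h => by simp only [hprefix ω ω' h]
      exact this (measurableSet_singleton (f x)).compl
    simp only [h₁]
    rw [MeasureTheory.lintegral_mul_const' _ _ (ENNReal.inv_ne_top.2 hpow),
      MeasureTheory.lintegral_finsetSum _ fun x _ => measurable_one.indicator (hm x),
      div_eq_mul_inv]
    congr 1
    exact Finset.sum_congr rfl fun x _ => MeasureTheory.lintegral_indicator_one (hm x)
  have hC' : ∫⁻ ω, ENNReal.ofReal ((∑ x, ((revealed n (final x ω)).card : ℝ)) / 2 ^ n) ∂coinLaw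
      ≤ ENNReal.ofReal D := by
    refine le_trans (le_of_eq ?_) hD
    have h₁ : ∀ ω, ENNReal.ofReal ((∑ x, ((revealed n (final x ω)).card : ℝ)) / 2 ^ n)
        = (∑ x, ((revealed n (final x ω)).card : ℝ≥0∞)) * (2 ^ n)⁻¹ := by
      intro ω
      rw [ENNReal.ofReal_div_of_pos (by positivity), ENNReal.ofReal_pow (by norm_num),
        ENNReal.ofReal_sum_of_nonneg fun _ _ => Nat.cast_nonneg _, div_eq_mul_inv]
      simp
    simp only [h₁]
    rw [MeasureTheory.lintegral_mul_const' _ _ (ENNReal.inv_ne_top.2 hpow),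
      MeasureTheory.lintegral_finsetSum, div_eq_mul_inv]
    exact fun x _ => measurable_of_prefix q fun ω ω' h => by simp only [hprefix ω ω' h]
  have h₁ := coinLaw_markov hE ha hE' hea
  have h₂ := coinLaw_markov hC hb hC' hDb
  -- Union bound: large error and large cost each have probability at most `δ / 2`.
  rw [ENNReal.ofReal_sub _ hδ, ENNReal.ofReal_one, tsub_le_iff_right]
  have huniv : coinLaw (Set.univ : Set (ℕ → Bool)) = 1 := MeasureTheory.measure_univ
  rw [← huniv]
  refine le_trans (MeasureTheory.measure_mono (t := {ω |
      disagreement (fun x => (final x ω).output.truth) f < a ∧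
      (∑ x, ((revealed n (final x ω)).card : ℝ)) / 2 ^ n < b} ∪
    ({ω | ENNReal.ofReal a
        ≤ ENNReal.ofReal (disagreement (fun x => (final x ω).output.truth) f)} ∪
      {ω | ENNReal.ofReal b
        ≤ ENNReal.ofReal ((∑ x, ((revealed n (final x ω)).card : ℝ)) / 2 ^ n)})) ?_) ?_
  · intro ω _
    simp only [Set.mem_union, Set.mem_ofPred_eq]
    by_contra hcon
    push Not at hcon
    obtain ⟨hc₁, hc₂, hc₃⟩ := hcon
    have h₃ := (ENNReal.ofReal_lt_ofReal_iff ha).1 hc₂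
    have h₄ := (ENNReal.ofReal_lt_ofReal_iff hb).1 hc₃
    linarith [hc₁ h₃]
  · refine (MeasureTheory.measure_union_le _ _).trans (add_le_add le_rfl ?_)
    refine (MeasureTheory.measure_union_le _ _).trans ((add_le_add h₁ h₂).trans ?_)
    rw [← ENNReal.ofReal_add (by linarith) (by linarith)]
    exact ENNReal.ofReal_le_ofReal (by linarith)

/-- The time of the learner as a polynomial, up to the factor `4 ^ d`. -/
lemma exists_learnTime_eq (b c a a' M : ℕ) (hM : a * (a' * c) = M) (p : Polynomial ℕ) :
    ∃ P : Polynomial ℕ, (∀ n : ℕ, 1 ≤ P.eval n) ∧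
      ∀ n d, learnTime b c n a a' (n + M + 3) (p.eval n) d = 4 ^ d * P.eval n := by
  refine ⟨4 * (p * (4 * (.X + .C M + 3 + p) + 24) + .C b + 3 * .C M + 10 * .X + 100) + 3 * .C M + 40
    + .C (((c + 3) * a' + 4) * a) + 3 * .X + 30, fun n => ?_, fun n d => ?_⟩
  · simp only [Polynomial.eval_add, Polynomial.eval_ofNat]
    omega
  · simp only [learnTime, roundTime, taskTime, hM, Polynomial.eval_add, Polynomial.eval_mul,
      Polynomial.eval_X, Polynomial.eval_C, Polynomial.eval_ofNat]

/-- The learner made from an efficient strategy learns small decision trees. -/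
theorem properlyLearnsTrees_of_strategy {S : Prog StrategyOracle} {C : ℝ} {k c : ℕ}
    (hc : 4 ≤ c) (hC : 4 * C ≤ c) (hS : IsEfficientStrategy S C k) :
    ProperlyLearnsTrees (learner S c) k := by
  intro ε δ hε hε1 hδ hδ1
  obtain ⟨M, hM⟩ : ∃ M, ε.den * (δ.den * c) = M := ⟨_, rfl⟩
  have hεd : 1 ≤ ε.den := ε.pos
  have hδd : 1 ≤ δ.den := δ.pos
  have hM4 : 4 ≤ M := by
    rw [← hM]
    calc 4 ≤ c := hc
      _ = 1 * (1 * c) := by ring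
      _ ≤ _ := Nat.mul_le_mul hεd (Nat.mul_le_mul hδd le_rfl)
  have hM0 : (0 : ℝ) < M := by exact_mod_cast (by omega : 0 < M)
  have hεR : (0 : ℝ) < ε := by exact_mod_cast hε
  have hδR : (0 : ℝ) < δ := by exact_mod_cast hδ
  have one_le_den_mul : ∀ a : ℚ, 0 < a → (1 : ℝ) ≤ a.den * a := by
    intro a ha
    have h₁ : (a.den : ℚ) * a = a.num := Rat.den_mul_eq_num a
    have h₂ : (1 : ℚ) ≤ a.num := by exact_mod_cast Rat.num_pos.2 ha
    rw [← h₁] at h₂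
    exact_mod_cast h₂
  have hε₁ := one_le_den_mul ε hε
  have hδ₁ := one_le_den_mul δ hδ
  have hMR : (M : ℝ) = ε.den * (δ.den * c) := by rw [← hM]; push_cast; ring
  -- With `4 * C ≤ c` this gives `C / M ≤ (δ / 2) * (ε / 2)`, the slack that Markov's inequality
  -- over the coins needs.
  have hεδ : (c : ℝ) ≤ M * (ε * δ) := by
    have : (1 : ℝ) ≤ (ε.den * ε) * (δ.den * δ) := by nlinarith
    rw [hMR]
    have hc0 : (0 : ℝ) ≤ c := Nat.cast_nonneg c
    nlinarith
  have hε' : (0 : ℚ) < (M : ℚ)⁻¹ := by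
    have : (0 : ℚ) < M := by exact_mod_cast (by omega : 0 < M)
    positivity
  have hε'' : (M : ℚ)⁻¹ < 1 / 2 := by
    rw [inv_lt_comm₀ (by exact_mod_cast (by omega : 0 < M)) (by norm_num)]
    norm_num
    exact_mod_cast (by omega : 2 < M)
  obtain ⟨p, g, hg, hgb, hpg⟩ := hS _ hε' hε''
  obtain ⟨G, hG₀, hGg, hGo⟩ := exists_monotone_majorant hg hgb
  obtain ⟨P, hP1, hP⟩ := exists_learnTime_eq S.regBound c ε.den δ.den M hM p
  let D : ℕ → ℝ := fun n => logSize k n * G (logSize k n)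
  have hD0 : ∀ n, 0 ≤ D n := fun n =>
    mul_nonneg (zero_le_one.trans (one_le_logSize k n)) (hG₀ _)
  -- The depth at which `truncCount_mul_lt` applies to average cost below `2 * (D n + 1) / δ`. It
  -- enters the analysis only.
  let d : ℕ → ℕ := fun n => ⌈M * (2 * (D n + 1) / δ)⌉₊
  have hd : (fun n => (d n : ℝ)) =o[Filter.atTop] fun n : ℕ => Real.log n * Real.log n := by
    have h₁ : (fun n => M * (2 * (D n + 1) / δ) + 1) =o[Filter.atTop]
        fun n : ℕ => Real.log n * Real.log n := by
      have hconst : ∀ a : ℝ, (fun _ : ℕ => a) =o[Filter.atTop]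
          fun n : ℕ => Real.log n * Real.log n :=
        fun a => (const_isLittleO_log a).trans log_isLittleO_sq
      have h₂ := (((logSize_mul_isLittleO hGo k).add (hconst 1)).const_mul_left
        (M * (2 / (δ : ℝ)))).add (hconst 1)
      refine h₂.congr_left fun n => ?_
      simp only [D]
      ring
    refine Asymptotics.IsBigO.trans_isLittleO (Asymptotics.IsBigO.of_bound 1 ?_) h₁
    refine Filter.Eventually.of_forall fun n => ?_
    have h₂ : 0 ≤ M * (2 * (D n + 1) / δ) := by
      have := hD0 n
      positivity
    rw [Real.norm_of_nonneg (Nat.cast_nonneg _), Real.norm_of_nonneg (by linarith), one_mul]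
    exact (Nat.ceil_lt_add_one h₂).le
  obtain ⟨r, hr, hT⟩ := exists_exponent P hP1 d hd
  refine ⟨fun n => 4 ^ d n * P.eval n, r, hr, hT, fun n f hf => ?_⟩
  obtain ⟨final, hfin, herr, hcost⟩ := hpg n f hf
  rw [strategyInput_inv n (by omega)] at hfin
  have hruns : ∀ ω, RunsTo f ω S (.cons (.num n) (.cons (.num 1) (.num M))) (p.eval n)
      fun x => final x ω := fun ω x => hfin x ω
  have hDn := hD0 n
  -- Half of `ε` goes to the error of the strategy, half to truncation. The `+ 1` keeps the cost
  -- threshold positive when `D n = 0`.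
  refine (coinLaw_good hruns (a := ε / 2) (b := 2 * (D n + 1) / δ) (δ := δ) (by positivity)
    (by positivity) herr (cost_le_logSize hf hGg hcost) ?_ ?_ hδR.le).trans
    (MeasureTheory.measure_mono ?_)
  · push_cast
    rw [← div_eq_mul_inv, div_le_iff₀ hM0]
    nlinarith
  · have : (δ : ℝ) / 2 * (2 * (D n + 1) / δ) = D n + 1 := by field_simp
    rw [this]
    simp only [D]
    linarith
  · rintro ω ⟨h₁, h₂⟩
    have hloc := (hruns ω).locallyDetermined
    have hlt := truncCount_mul_lt (M := M) (d := d n) hloc h₂ (Nat.le_ceil _)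
    have hruns' := hruns ω
    subst hM
    obtain ⟨t, s, hex, ht, d', hd', htr, hout⟩ :=
      wp_learner (c := c) (ε := ε) (δ := δ) hruns' le_rfl hlt
    rw [hP] at ht
    refine ⟨t, ht, s, _, hex, hout, (size_strategyTree_le d' _).trans ?_, ?_⟩
    · calc 2 ^ d' ≤ 4 ^ d' := Nat.pow_le_pow_left (by norm_num) _
        _ ≤ 4 ^ d n := Nat.pow_le_pow_right (by norm_num) hd'
        _ ≤ 4 ^ d n * P.eval n := Nat.le_mul_of_pos_right _ (hP1 n)
    · refine (disagreement_strategyTree_le hloc h₁ (b := ε / 2) ?_ htr).trans (by linarith)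
      -- Truncation costs at most `1 / M ≤ ε / 2`, from `ε.den * ε ≥ 1` and `δ.den * c ≥ 4`.
      rw [hMR]
      have hc' : (4 : ℝ) ≤ c := by exact_mod_cast hc
      have h₃ : (1 : ℝ) ≤ δ.den := by exact_mod_cast hδd
      have h₄ : (4 : ℝ) ≤ δ.den * c := by nlinarith
      nlinarith

end PricedQuery

end

theorem mainTheorem9 (K : Set ℕ)
    (hS : ∃ (S : PricedQuery.Prog PricedQuery.StrategyOracle) (C : ℝ),
      ∀ k ∈ K, PricedQuery.IsEfficientStrategy S C k) :
    ∃ L : PricedQuery.Prog Unit, ∀ k ∈ K, PricedQuery.ProperlyLearnsTrees L k := by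
  obtain ⟨S, C, hS⟩ := hS
  -- The summand `1` ensures `4 ≤ c` even if `C ≤ 0`, so that `1 / M < 1 / 2` is an admissible error
  -- parameter.
  refine ⟨PricedQuery.learner S (4 * (⌈C⌉₊ + 1)), fun k hk =>
    PricedQuery.properlyLearnsTrees_of_strategy (by omega) ?_ (hS k hk)⟩
  have := Nat.le_ceil C
  push_cast
  linarith
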